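/- Let $\mathcal H$ be an infinite-dimensional separable real Hilbert space (for instance $L^2[0,1]$), and for $a,b\in\mathcal H$ write $a\otimes b$ for the operator $v\mapsto\langle a,v\rangle b$. Let $x_t,y_t,z_t,u_t$ ($t\ge 1$) be $\mathcal H$-valued random variables on a probability space, $\mathcal A$ a bounded linear operator on $\mathcal H$, $\mathcal C_{xz}=\mathbb E[x_t\otimes z_t]$, $\widehat{\mathcal C}_{xz}=T^{-1}\sum_{t=1}^T x_t\otimes z_t$, and similarly for other pairs of processes. Let $\mathfrak F_{t}=\sigma(\{z_s\}_{1\le s\le t+1},\{u_s\}_{1\le s\le t})$. Assume the following. (1) $y_t=\mathcal A x_t+u_t$, with $\mathbb E[x_t]=\mathbb E[z_t]=\mathbb E[u_t]=0$ and $\mathbb E[x_t\otimes u_t]\ne0$. (2) $\{(x_t,z_t)\}_{t\ge1}$ is strictly stationary and strongly ($\alpha$-)mixing with geometrically decaying mixing coefficients, $\mathbb E\|x_t\|^2<\infty$ and $\mathbb E\|z_t\|^2<\infty$. (3) $\mathbb E[u_t\mid\mathfrak F_{t-1}]=0$, $\mathbb E[u_t\otimes u_t\mid\mathfrak F_{t-1}]=\mathcal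 C_{uu}$, and for some $\delta>0$, $\mathbb E\|u_t\|^{2+\delta}<\infty$ for all $t$ and $\sup_t\mathbb E[\|u_t\|^{2+\delta}\mid\mathfrak F_{t-1}]<\infty$ a.s. (4) $\ker\mathcal C_{xz}^*\mathcal C_{xz}=\{0\}$, $\mathcal A$ is Hilbert–Schmidt, and the eigenvalues of $\mathcal C_{xz}^*\mathcal C_{xz}$ satisfy $\lambda_1^2>\lambda_2^2>\dots>0$. (5) In Hilbert–Schmidt norm, $\|\widehat{\mathcal C}_{xz}-\mathcal C_{xz}\|$, $\|\widehat{\mathcal C}_{zz}-\mathcal C_{zz}\|$ and $\|\widehat{\mathcal C}_{uz}-\mathcal C_{uz}\|$ are $O_p(T^{-1/2})$, and $\|\widehat{\mathcal C}_{uu}-\mathcal C_{uu}\|=o_p(1)$. (6) For some constants $m_x,m_z,m_u$, almost surely $\sup_t\|x_t\|\le m_x$, $\sup_t\|z_t\|\le m_z$ and $\sup_t\|u_t\|\le m_u$. (7) The eigenvalues $\Lambda_1\ge\Lambda_2\ge\dots$ (with multiplicity) of the covariance operator of $x_t\otimes z_t$, regarded as a random element of the Hilbert space of Hilbert–Schmidt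 operators on $\mathcal H$, satisfy $\Lambda_j\le ab^j$ for all $j$, for some $a>0$ and $0<b<1$. Let $\hat\lambda_1^2\ge\hat\lambda_2^2\ge\dots\ge0$ and $\hat f_1,\hat f_2,\dots$ be the eigenvalues (with multiplicity) of $\widehat{\mathcal C}_{xz}^*\widehat{\mathcal C}_{xz}$ and any corresponding orthonormal eigenvectors. For $\alpha>0$ put $\mathrm K=\#\{j:\hat\lambda_j^2>\alpha\}$ and $$\widehat{\mathcal A}=\widehat{\mathcal C}_{yz}^*\widehat{\mathcal C}_{xz}\sum_{j=1}^{\mathrm K}\hat\lambda_j^{-2}\,\hat f_j\otimes\hat f_j,\qquad \tau(\alpha)=\sum_{j=1}^{\mathrm K}\tau_j,$$ where $\tau_j=2\sqrt2\max\{(\lambda_{j-1}^2-\lambda_j^2)^{-1},(\lambda_j^2-\lambda_{j+1}^2)^{-1}\}$ for $j\ge2$ and $\tau_1=2\sqrt2(\lambda_1^2-\lambda_2^2)^{-1}$. Let $\alpha=\alpha_T>0$ be deterministic with $\alpha_T\to0$ as $T\to\infty$. If $\tau(\alpha_T)=o(T^{1/2}\log^{-3/2}T)$ almost surely and $\alpha_T^{-1}T^{-1}\log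 T\to0$, then $\|\widehat{\mathcal A}-\mathcal A\|_{\mathrm{op}}\to0$ almost surely as $T\to\infty$. -/

import Mathlib

open MeasureTheory Filter Topology Asymptotics
open scoped InnerProductSpace

namespace FIVE

noncomputable section

section HilbertSchmidtSpace

variable (H : Type*) [NormedAddCommGroup H] [InnerProductSpace ℝ H] [CompleteSpace H]

/-- Index set of a fixed orthonormal basis of `H`. -/
def basisIndex : Set H := (exists_hilbertBasis ℝ H).choose

/-- A fixed orthonormal (Hilbert) basis of `H`. -/
def stdBasis : HilbertBasis (basisIndex H) ℝ H := (exists_hilbertBasis ℝ H).choose_spec.choose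

variable {H}

/-- `T` is Hilbert-Schmidt: `∑ ‖T e_i‖ ^ 2 < ∞` for an orthonormal basis `(e_i)`
(the sum does not depend on the basis). -/
def IsHilbertSchmidt (T : H →L[ℝ] H) : Prop := Summable fun i => ‖T (stdBasis H i)‖ ^ 2

lemma isHilbertSchmidt_iff (T : H →L[ℝ] H) :
    IsHilbertSchmidt T ↔ Memℓp (fun i => T (stdBasis H i)) 2 := by
  rw [memℓp_gen_iff (by norm_num)]
  simp [IsHilbertSchmidt]

variable (H)

/-- The linear space of Hilbert-Schmidt operators. -/
def hsSubmodule : Submodule ℝ (H →L[ℝ] H) where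
  carrier := {T | IsHilbertSchmidt T}
  add_mem' {S T} hS hT := by
    simp only [Set.mem_ofPred_eq, isHilbertSchmidt_iff] at *
    exact hS.add hT
  zero_mem' := by simp [IsHilbertSchmidt, summable_zero]
  smul_mem' c T hT := by
    simp only [Set.mem_ofPred_eq, isHilbertSchmidt_iff] at *
    exact hT.const_smul c

/-- The type of Hilbert-Schmidt operators on `H`. It is a type of its own because it carries the
Hilbert-Schmidt inner product and norm, not the operator norm. -/
def HilbertSchmidt : Type _ := ↥(hsSubmodule H)

variable {H}

/-- The underlying bounded operator. -/
def HilbertSchmidt.toCLM (T : HilbertSchmidt H) : H →L[ℝ] H := T.1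

instance : AddCommGroup (HilbertSchmidt H) := inferInstanceAs (AddCommGroup ↥(hsSubmodule H))

instance : Module ℝ (HilbertSchmidt H) := inferInstanceAs (Module ℝ ↥(hsSubmodule H))

/-- The images of the basis vectors, as a square-summable family. -/
def HilbertSchmidt.toL2 : HilbertSchmidt H →ₗ[ℝ] lp (fun _ : basisIndex H => H) 2 where
  toFun T := ⟨fun i => T.toCLM (stdBasis H i), (isHilbertSchmidt_iff _).1 T.2⟩
  map_add' _ _ := rfl
  map_smul' _ _ := rfl

lemma HilbertSchmidt.toL2_injective : Function.Injective (HilbertSchmidt.toL2 (H := H)) := by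
  intro S T h
  apply Subtype.ext
  refine ContinuousLinearMap.ext_on (s := Set.range (stdBasis H)) ?_ ?_
  · have := (stdBasis H).dense_span
    exact (Submodule.dense_iff_topologicalClosure_eq_top).2 this
  · rintro _ ⟨i, rfl⟩
    exact congrFun (congrArg Subtype.val h) i

/-- The Hilbert-Schmidt norm `‖T‖ = (∑ ‖T e_i‖ ^ 2) ^ (1 / 2)`. -/
instance : NormedAddCommGroup (HilbertSchmidt H) :=
  NormedAddCommGroup.induced _ _ HilbertSchmidt.toL2 HilbertSchmidt.toL2_injective

/-- The Hilbert-Schmidt inner product `⟪S, T⟫ = ∑ ⟪S e_i, T e_i⟫`. -/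
instance : InnerProductSpace ℝ (HilbertSchmidt H) where
  norm_smul_le c T := by
    change ‖HilbertSchmidt.toL2 (c • T)‖ ≤ ‖c‖ * ‖HilbertSchmidt.toL2 T‖
    rw [map_smul, norm_smul]
  inner S T := ⟪HilbertSchmidt.toL2 S, HilbertSchmidt.toL2 T⟫_ℝ
  norm_sq_eq_re_inner T := norm_sq_eq_re_inner (𝕜 := ℝ) (HilbertSchmidt.toL2 T)
  conj_inner_symm S T :=
    inner_conj_symm (𝕜 := ℝ) (HilbertSchmidt.toL2 S) (HilbertSchmidt.toL2 T)
  add_left S T R := by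
    simp only [map_add, inner_add_left]
  smul_left S T c := by
    simp only [map_smul, inner_smul_left]

lemma HilbertSchmidt.toL2_surjective : Function.Surjective (HilbertSchmidt.toL2 (H := H)) := by
  intro v
  have hv : Summable fun i => ‖v i‖ ^ 2 := by
    have := (memℓp_gen_iff (p := 2) (by norm_num)).1 v.2
    simpa using this
  have key (x : H) : Summable (fun i => ‖⟪stdBasis H i, x⟫_ℝ • v i‖) ∧
      ∑' i, ‖⟪stdBasis H i, x⟫_ℝ • v i‖ ≤ ‖v‖ * ‖x‖ := by
    have hx : HasSum (fun i => ‖⟪stdBasis H i, x⟫_ℝ‖ ^ (2 : ℝ)) (‖x‖ ^ (2 : ℝ)) := by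
      have h := lp.hasSum_norm (p := 2) (by norm_num) ((stdBasis H).repr x)
      simpa [HilbertBasis.repr_apply_apply] using h
    have hv' : HasSum (fun i => ‖v i‖ ^ (2 : ℝ)) (‖v‖ ^ (2 : ℝ)) := by
      have h := lp.hasSum_norm (p := 2) (by norm_num) v
      simpa using h
    have hpq : (2 : ℝ).HolderConjugate 2 := by
      constructor <;> norm_num
    obtain ⟨C, hC0, hC, hsum⟩ := Real.inner_le_Lp_mul_Lq_hasSum_of_nonneg hpq
      (norm_nonneg v) (norm_nonneg x) (fun i => norm_nonneg _) (fun i => norm_nonneg _) hv' hx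
    have hs : HasSum (fun i => ‖⟪stdBasis H i, x⟫_ℝ • v i‖) C := by
      simpa only [norm_smul, mul_comm] using hsum
    exact ⟨hs.summable, hs.tsum_eq.le.trans hC⟩
  let T₀ : H →ₗ[ℝ] H :=
    { toFun := fun x => ∑' i, ⟪stdBasis H i, x⟫_ℝ • v i
      map_add' := fun x y => by
        rw [← ((key x).1.of_norm).tsum_add ((key y).1.of_norm)]
        simp only [inner_add_right, add_smul]
      map_smul' := fun c x => by
        rw [RingHom.id_apply, ← ((key x).1.of_norm).tsum_const_smul c]
        simp only [inner_smul_right, mul_smul] }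
  let T : H →L[ℝ] H := T₀.mkContinuous ‖v‖ fun x =>
    (norm_tsum_le_tsum_norm (key x).1).trans (key x).2
  have hT (i : basisIndex H) : T (stdBasis H i) = v i := by
    change ∑' j, ⟪stdBasis H j, stdBasis H i⟫_ℝ • v j = v i
    rw [tsum_eq_single i]
    · rw [real_inner_self_eq_norm_sq, (stdBasis H).orthonormal.1 i]
      simp
    · intro j hj
      rw [(stdBasis H).orthonormal.2 hj, zero_smul]
  refine ⟨⟨T, ?_⟩, ?_⟩
  · change Summable fun i => ‖T (stdBasis H i)‖ ^ 2
    simpa only [hT] using hv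
  · apply Subtype.ext
    funext i
    exact hT i

instance : CompleteSpace (HilbertSchmidt H) := by
  have hiso : Isometry (HilbertSchmidt.toL2 (H := H)) :=
    AddMonoidHomClass.isometry_of_norm _ fun _ => rfl
  refine (completeSpace_congr (e := Equiv.ofBijective _
    ⟨HilbertSchmidt.toL2_injective, HilbertSchmidt.toL2_surjective⟩) ?_).2 inferInstance
  exact hiso.isUniformEmbedding

end HilbertSchmidtSpace

section Operators

variable {E F : Type*} [NormedAddCommGroup E] [InnerProductSpace ℝ E]
  [NormedAddCommGroup F] [InnerProductSpace ℝ F]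

/-- The tensor product `a ⊗ b`, that is, the operator `v ↦ ⟪a, v⟫ b`. -/
def tensor (a : E) (b : F) : E →L[ℝ] F := InnerProductSpace.rankOne ℝ b a

/-- `C = ∑ j, lam j • (e j ⊗ e j)` with orthonormal `e` and `lam 0 ≥ lam 1 ≥ … ≥ 0`: the spectral
decomposition of a nonnegative self-adjoint compact operator on an infinite-dimensional space. The
positive terms of `lam` are the positive eigenvalues in decreasing order with multiplicity. -/
structure SpectralDecomposition (C : E →L[ℝ] E) (lam : ℕ → ℝ) (e : ℕ → E) : Prop where
  orthonormal : Orthonormal ℝ e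
  antitone : Antitone lam
  nonneg : ∀ j, 0 ≤ lam j
  hasSum : ∀ v, HasSum (fun j => lam j • tensor (e j) (e j) v) (C v)

variable {H : Type*} [NormedAddCommGroup H] [InnerProductSpace ℝ H] [CompleteSpace H]

lemma isHilbertSchmidt_tensor (a b : H) : IsHilbertSchmidt (tensor a b) := by
  have h := (memℓp_gen_iff (p := 2) (by norm_num)).1 ((stdBasis H).repr a).2
  have h2 : Summable fun i => ‖⟪stdBasis H i, a⟫_ℝ‖ ^ 2 := by
    simpa [HilbertBasis.repr_apply_apply] using h
  refine (h2.mul_right (‖b‖ ^ 2)).congr fun i => ?_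
  simp [tensor, norm_smul, mul_pow, real_inner_comm]

/-- `a ⊗ b` as an element of the Hilbert space of Hilbert-Schmidt operators. -/
def tensorHS (a b : H) : HilbertSchmidt H := ⟨tensor a b, isHilbertSchmidt_tensor a b⟩

end Operators

section Moments

variable {Ω : Type*} [MeasurableSpace Ω] (μ : Measure Ω)
variable {E F : Type*} [NormedAddCommGroup E] [InnerProductSpace ℝ E]
  [NormedAddCommGroup F] [InnerProductSpace ℝ F]

/-- `E[X ⊗ Y]`. -/
def crossMoment (X : Ω → E) (Y : Ω → F) : E →L[ℝ] F := ∫ ω, tensor (X ω) (Y ω) ∂μ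

/-- The covariance operator `E[(X - E X) ⊗ (X - E X)]`. -/
def covOp (X : Ω → E) : E →L[ℝ] E :=
  crossMoment μ (fun ω => X ω - ∫ η, X η ∂μ) (fun ω => X ω - ∫ η, X η ∂μ)

variable {H : Type*} [NormedAddCommGroup H] [InnerProductSpace ℝ H] [CompleteSpace H]

/-- `E[X ⊗ Y]` as a Hilbert-Schmidt operator. -/
def crossMomentHS (X Y : Ω → H) : HilbertSchmidt H := ∫ ω, tensorHS (X ω) (Y ω) ∂μ

end Moments

section Processes

variable {Ω : Type*} [MeasurableSpace Ω] (μ : Measure Ω)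

/-- Strict stationarity: the law of the process, on the space of trajectories, is invariant under
time shifts. -/
def StrictlyStationary {S : Type*} [MeasurableSpace S] (w : ℕ → Ω → S) : Prop :=
  ∀ h : ℕ, μ.map (fun ω t => w (t + h) ω) = μ.map (fun ω t => w t ω)

/-- Strong (alpha-) mixing at a geometric rate: the mixing coefficients
`sup |P(A ∩ B) - P(A) P(B)|`, over `A` in the past up to time `n` and `B` in the future from time
`n + k` on, are at most `c r ^ k` for some `r < 1`. -/
def GeometricallyStronglyMixing {S : Type*} [MeasurableSpace S] (w : ℕ → Ω → S) : Prop :=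
  ∃ c r : ℝ, 0 < r ∧ r < 1 ∧ ∀ k n : ℕ, 1 ≤ k → ∀ A B : Set Ω,
    MeasurableSet[⨆ s ≤ n, MeasurableSpace.comap (w s) inferInstance] A →
    MeasurableSet[⨆ s ≥ n + k, MeasurableSpace.comap (w s) inferInstance] B →
    |μ.real (A ∩ B) - μ.real A * μ.real B| ≤ c * r ^ k

/-- `X T = O_p(r T)` as `T → ∞`. -/
def IsBigOInProbability {S : Type*} [Norm S] (X : ℕ → Ω → S) (r : ℕ → ℝ) : Prop :=
  ∀ ε : ℝ, 0 < ε → ∃ M : ℝ, ∀ᶠ T in atTop, μ {ω | M * r T < ‖X T ω‖} ≤ ENNReal.ofReal ε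

/-- The sigma-algebra generated by the instruments up to and including time `t` and the errors
strictly before time `t`. -/
abbrev pastSigma {S : Type*} [MeasurableSpace S] (z u : ℕ → Ω → S) (t : ℕ) : MeasurableSpace Ω :=
  (⨆ s ≤ t, MeasurableSpace.comap (z s) inferInstance) ⊔
    (⨆ s < t, MeasurableSpace.comap (u s) inferInstance)

end Processes

section Estimator

variable {Ω : Type*}
variable {H : Type*} [NormedAddCommGroup H] [InnerProductSpace ℝ H] [CompleteSpace H]

/-- The sample cross-moment `T⁻¹ ∑ X_t ⊗ Y_t` over the first `T` observations. Processes are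
indexed from `0`, so that the observation times are `0, …, T - 1`. -/
def sampleMoment (X Y : ℕ → Ω → H) (T : ℕ) (ω : Ω) : H →L[ℝ] H :=
  (T : ℝ)⁻¹ • ∑ t ∈ Finset.range T, tensor (X t ω) (Y t ω)

/-- The sample cross-moment as a Hilbert-Schmidt operator. -/
def sampleMomentHS (X Y : ℕ → Ω → H) (T : ℕ) (ω : Ω) : HilbertSchmidt H :=
  (T : ℝ)⁻¹ • ∑ t ∈ Finset.range T, tensorHS (X t ω) (Y t ω)

/-- The number `K` of eigenvalues (with multiplicity) that exceed the threshold `α`. -/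
def numRetained (ev : ℕ → ℝ) (α : ℝ) : ℕ := {j | α < ev j}.ncard

/-- The rank-regularized inverse `∑ j < K, (ev j)⁻¹ • (e j ⊗ e j)`. -/
def regInverse (ev : ℕ → ℝ) (e : ℕ → H) (K : ℕ) : H →L[ℝ] H :=
  ∑ j ∈ Finset.range K, (ev j)⁻¹ • tensor (e j) (e j)

/-- The functional IV estimator computed from the first `T` observations, with threshold `α`, where
`(ev, e)` are the eigenvalues and eigenfunctions of `Ĉ_xz* Ĉ_xz`. -/
def estimator (x y z : ℕ → Ω → H) (T : ℕ) (ω : Ω) (ev : ℕ → ℝ) (e : ℕ → H) (α : ℝ) :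
    H →L[ℝ] H :=
  (sampleMoment y z T ω).adjoint ∘L sampleMoment x z T ω ∘L regInverse ev e (numRetained ev α)

/-- `2 √2` times the larger of the reciprocals of the gaps between the eigenvalue of index `j` and
its neighbours. The first eigenvalue has only one neighbour. -/
def gapWeight (lam : ℕ → ℝ) : ℕ → ℝ
  | 0 => 2 * √2 * (lam 0 - lam 1)⁻¹
  | j + 1 => 2 * √2 * max (lam j - lam (j + 1))⁻¹ (lam (j + 1) - lam (j + 2))⁻¹

end Estimator

section Assumptions

variable {Ω : Type*} [MeasurableSpace Ω] (μ : Measure Ω)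
variable {H : Type*} [NormedAddCommGroup H] [InnerProductSpace ℝ H] [CompleteSpace H]
  [MeasurableSpace H]

/-- The functional endogenous linear model and the conditions on it. All processes are indexed
from `0`. Here `lam j` is the eigenvalue number `j + 1` of `C_xz* C_xz` (a squared singular value
of `C_xz`) and `f j` is its eigenfunction. -/
structure ModelAssumption (A : H →L[ℝ] H) (x y z u : ℕ → Ω → H) (lam : ℕ → ℝ) (f : ℕ → H) :
    Prop where
  measurable_x : ∀ t, Measurable (x t)
  measurable_y : ∀ t, Measurable (y t)
  measurable_z : ∀ t, Measurable (z t)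
  measurable_u : ∀ t, Measurable (u t)
  /-- the model equation -/
  model : ∀ t, ∀ᵐ ω ∂μ, y t ω = A (x t ω) + u t ω
  endogenous : ∀ t, crossMoment μ (x t) (u t) ≠ 0
  mean_x : ∀ t, ∫ ω, x t ω ∂μ = 0
  mean_z : ∀ t, ∫ ω, z t ω ∂μ = 0
  mean_u : ∀ t, ∫ ω, u t ω ∂μ = 0
  /-- dependence and moments of regressor and instrument -/
  stationary : StrictlyStationary μ fun t ω => (x t ω, z t ω)
  mixing : GeometricallyStronglyMixing μ fun t ω => (x t ω, z t ω)
  sq_integrable_x : ∀ t, MemLp (x t) 2 μ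
  sq_integrable_z : ∀ t, MemLp (z t) 2 μ
  /-- the errors are homoscedastic martingale differences, with a higher conditional moment -/
  martingale_diff : ∀ t, μ[u t | pastSigma z u t] =ᵐ[μ] 0
  homoscedastic : ∀ t, μ[fun ω => tensor (u t ω) (u t ω) | pastSigma z u t] =ᵐ[μ]
    fun _ => crossMoment μ (u 0) (u 0)
  cond_moment : ∃ δ : ℝ, 0 < δ ∧ (∀ t, Integrable (fun ω => ‖u t ω‖ ^ (2 + δ)) μ) ∧
    ∀ᵐ ω ∂μ, BddAbove (Set.range fun t => (μ[fun η => ‖u t η‖ ^ (2 + δ) | pastSigma z u t]) ω)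
  /-- identification: `C_xz* C_xz` is injective -/
  identified : ∀ v, (crossMoment μ (x 0) (z 0)).adjoint (crossMoment μ (x 0) (z 0) v) = 0 → v = 0
  hilbertSchmidt : IsHilbertSchmidt A
  /-- the eigenvalues of `C_xz* C_xz` are positive and distinct -/
  spectral : SpectralDecomposition
    ((crossMoment μ (x 0) (z 0)).adjoint ∘L crossMoment μ (x 0) (z 0)) lam f
  strictAnti : StrictAnti lam
  pos : ∀ j, 0 < lam j
  /-- behaviour of sample moments -/
  sample_xz : IsBigOInProbability μ
    (fun T ω => sampleMomentHS x z T ω - crossMomentHS μ (x 0) (z 0)) (fun T => (√(T : ℝ))⁻¹)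
  sample_zz : IsBigOInProbability μ
    (fun T ω => sampleMomentHS z z T ω - crossMomentHS μ (z 0) (z 0)) (fun T => (√(T : ℝ))⁻¹)
  sample_uz : IsBigOInProbability μ
    (fun T ω => sampleMomentHS u z T ω - crossMomentHS μ (u 0) (z 0)) (fun T => (√(T : ℝ))⁻¹)
  sample_uu : TendstoInMeasure μ (sampleMomentHS u u) atTop fun _ => crossMomentHS μ (u 0) (u 0)

/-- The additional conditions: almost sure bounds, and geometric decay of the eigenvalues
`Λ 0 ≥ Λ 1 ≥ …` of the covariance operator of `x_t ⊗ z_t`, which by stationarity does not depend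
on `t`, in the Hilbert space of Hilbert-Schmidt operators. -/
structure StrongAssumption (x z u : ℕ → Ω → H) : Prop where
  bounded_x : ∃ m : ℝ, ∀ᵐ ω ∂μ, ∀ t, ‖x t ω‖ ≤ m
  bounded_z : ∃ m : ℝ, ∀ᵐ ω ∂μ, ∀ t, ‖z t ω‖ ≤ m
  bounded_u : ∃ m : ℝ, ∀ᵐ ω ∂μ, ∀ t, ‖u t ω‖ ≤ m
  eigenvalue_decay : ∃ (Λ : ℕ → ℝ) (e : ℕ → HilbertSchmidt H),
    SpectralDecomposition (covOp μ fun ω => tensorHS (x 0 ω) (z 0 ω)) Λ e ∧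
    ∃ a b : ℝ, 0 < a ∧ 0 < b ∧ b < 1 ∧ ∀ j, Λ j ≤ a * b ^ (j + 1)

end Assumptions

end

end FIVE

/-
Write `Ĉ` for `Ĉ_xz`, `R` for the regularized inverse of `Ĉ* Ĉ` and `P` for the projection onto the
retained eigenvectors, so that `Ĉ* Ĉ R = P`. Since `Ĉ_yz = Ĉ A* + Ĉ_uz`, the error splits as
`Â - A = Ĉ_uz* (Ĉ R) - A (1 - P)`.

Noise: `‖Ĉ R‖ ≤ α ^ (-1 / 2)`, because `(Ĉ R)* (Ĉ R) = R P`, and `T Ĉ_uz` is a martingale with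
bounded increments in the Hilbert space of Hilbert-Schmidt operators. The dimension-free
Azuma-Hoeffding inequality of Pinelis and Borel-Cantelli give `‖Ĉ_uz‖ = O((T⁻¹ log T) ^ (1 / 2))`
almost surely, so the noise is `O((α⁻¹ T⁻¹ log T) ^ (1 / 2))`.

Bias: `D = C_xz* C_xz` is the almost sure limit of `Ĉ* Ĉ`, by a strong law of large numbers for
bounded functions of a mixing process, and `‖(1 - P) D‖ ≤ α + ‖Ĉ* Ĉ - D‖ → 0`. As `D` is injective
and self-adjoint its range is dense, so `1 - P → 0` strongly, hence `A (1 - P) → 0` in operator norm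
because `A` is compact.
-/

namespace FIVE

section Azuma

lemma convexOn_cosh_sqrt : ConvexOn ℝ (Set.Ici 0) fun w => Real.cosh √w := by
  have hseries {w : ℝ} (hw : 0 ≤ w) :
      HasSum (fun k : ℕ => w ^ k / ((2 * k).factorial : ℝ)) (Real.cosh √w) := by
    simpa only [pow_mul, Real.sq_sqrt hw] using Real.hasSum_cosh √w
  refine ⟨convex_Ici 0, fun v hv w hw a b ha hb hab => ?_⟩
  refine hasSum_le (fun k => ?_)
    (hseries (add_nonneg (mul_nonneg ha hv) (mul_nonneg hb hw)))
    (((hseries hv).mul_left a).add ((hseries hw).mul_left b))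
  calc (a * v + b * w) ^ k / ((2 * k).factorial : ℝ)
      ≤ (a * v ^ k + b * w ^ k) / ((2 * k).factorial : ℝ) := by
        gcongr
        exact (convexOn_pow (𝕜 := ℝ) k).2 hv hw ha hb hab
    _ = a * (v ^ k / (2 * k).factorial) + b * (w ^ k / (2 * k).factorial) := by ring

variable {E : Type*} [NormedAddCommGroup E] [InnerProductSpace ℝ E]

/- With `s = ‖S‖` and `⟪S, d⟫ = θ s c`, the square of `‖S + d‖` is at most the average of
`(s - c) ^ 2` and `(s + c) ^ 2` with weights `(1 - θ) / 2` and `(1 + θ) / 2`. -/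
lemma cosh_norm_add_le (S : E) {d : E} {c : ℝ} (hd : ‖d‖ ≤ c) :
    Real.cosh ‖S + d‖ ≤ Real.cosh ‖S‖ * Real.cosh c +
      ⟪(Real.sinh ‖S‖ * Real.sinh c / (‖S‖ * c)) • S, d⟫_ℝ := by
  rcases eq_or_ne S 0 with rfl | hS
  · simpa [abs_of_nonneg ((norm_nonneg d).trans hd)] using hd
  rcases ((norm_nonneg d).trans hd).eq_or_lt with rfl | hc
  · simp [norm_le_zero_iff.1 hd]
  have hs : 0 < ‖S‖ := norm_pos_iff.2 hS
  obtain ⟨θ, hθ⟩ : ∃ θ, ⟪S, d⟫_ℝ = θ * (‖S‖ * c) :=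
    ⟨⟪S, d⟫_ℝ / (‖S‖ * c), (div_mul_cancel₀ _ (by positivity)).symm⟩
  obtain ⟨hθl, hθu⟩ : -1 ≤ θ ∧ θ ≤ 1 := by
    have h : |⟪S, d⟫_ℝ| ≤ ‖S‖ * c := (abs_real_inner_le_norm S d).trans (by gcongr)
    rw [hθ, abs_mul, abs_of_pos (mul_pos hs hc)] at h
    exact abs_le.1 (le_of_mul_le_mul_right (by rwa [one_mul]) (mul_pos hs hc))
  have hsq : ‖S + d‖ ^ 2 ≤ (1 - θ) / 2 * (‖S‖ - c) ^ 2 + (1 + θ) / 2 * (‖S‖ + c) ^ 2 := by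
    rw [norm_add_sq_real, hθ]
    nlinarith [norm_nonneg d]
  have hconv := convexOn_cosh_sqrt.2 (Set.mem_Ici.2 (sq_nonneg (‖S‖ - c)))
    (Set.mem_Ici.2 (sq_nonneg (‖S‖ + c))) (by linarith : 0 ≤ (1 - θ) / 2)
    (by linarith : 0 ≤ (1 + θ) / 2) (by ring)
  simp only [smul_eq_mul, Real.sqrt_sq_eq_abs, Real.cosh_abs] at hconv
  calc Real.cosh ‖S + d‖
      ≤ Real.cosh √((1 - θ) / 2 * (‖S‖ - c) ^ 2 + (1 + θ) / 2 * (‖S‖ + c) ^ 2) := by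
        rw [Real.cosh_le_cosh, abs_norm, abs_of_nonneg (Real.sqrt_nonneg _)]
        exact Real.le_sqrt_of_sq_le hsq
    _ ≤ (1 - θ) / 2 * Real.cosh (‖S‖ - c) + (1 + θ) / 2 * Real.cosh (‖S‖ + c) := hconv
    _ = Real.cosh ‖S‖ * Real.cosh c +
          ⟪(Real.sinh ‖S‖ * Real.sinh c / (‖S‖ * c)) • S, d⟫_ℝ := by
        rw [Real.cosh_add, Real.cosh_sub, real_inner_smul_left, hθ]
        field_simp
        ring

lemma abs_inner_sinh_smul_le (S : E) {d : E} {c : ℝ} (hd : ‖d‖ ≤ c) :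
    |⟪(Real.sinh ‖S‖ * Real.sinh c / (‖S‖ * c)) • S, d⟫_ℝ| ≤ Real.sinh ‖S‖ * Real.sinh c := by
  have hc : 0 ≤ c := (norm_nonneg d).trans hd
  have hsc : 0 ≤ Real.sinh ‖S‖ * Real.sinh c :=
    mul_nonneg (Real.sinh_nonneg_iff.2 (norm_nonneg S)) (Real.sinh_nonneg_iff.2 hc)
  rw [real_inner_smul_left, abs_mul, abs_div, abs_of_nonneg hsc,
    abs_of_nonneg (mul_nonneg (norm_nonneg S) hc)]
  calc Real.sinh ‖S‖ * Real.sinh c / (‖S‖ * c) * |⟪S, d⟫_ℝ|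
      ≤ Real.sinh ‖S‖ * Real.sinh c / (‖S‖ * c) * (‖S‖ * c) := by
        gcongr
        exact (abs_real_inner_le_norm S d).trans (by gcongr)
    _ ≤ Real.sinh ‖S‖ * Real.sinh c := by
        rw [div_mul_eq_mul_div, mul_div_assoc]
        exact mul_le_of_le_one_right hsc (div_self_le_one _)

variable [CompleteSpace E] {Ω : Type*} {m mΩ : MeasurableSpace Ω} {μ : Measure Ω}

lemma integral_inner_eq_zero_of_condExp_eq_zero (hm : m ≤ mΩ) [SigmaFinite (μ.trim hm)]
    {W d : Ω → E} (hW : StronglyMeasurable[m] W) (hWd : Integrable (fun ω => ⟪W ω, d ω⟫_ℝ) μ)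
    (hd : Integrable d μ) (h0 : μ[d | m] =ᵐ[μ] 0) : ∫ ω, ⟪W ω, d ω⟫_ℝ ∂μ = 0 := by
  have hpull : μ[fun ω => ⟪W ω, d ω⟫_ℝ | m] =ᵐ[μ] fun ω => ⟪W ω, (μ[d | m]) ω⟫_ℝ :=
    condExp_bilin_of_stronglyMeasurable_left (innerSL ℝ) hW hWd hd
  rw [← integral_condExp hm, integral_congr_ae hpull]
  refine integral_eq_zero_of_ae ?_
  filter_upwards [h0] with ω hω
  rw [hω, Pi.zero_apply, inner_zero_right, Pi.zero_apply]

lemma integral_cosh_norm_add_le (hm : m ≤ mΩ) [SigmaFinite (μ.trim hm)] {S d : Ω → E} {c : ℝ}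
    (hS : StronglyMeasurable[m] S) (hSi : Integrable (fun ω => Real.cosh ‖S ω‖) μ)
    (hd : Integrable d μ) (hdc : ∀ᵐ ω ∂μ, ‖d ω‖ ≤ c) (h0 : μ[d | m] =ᵐ[μ] 0) :
    Integrable (fun ω => Real.cosh ‖S ω + d ω‖) μ ∧
      ∫ ω, Real.cosh ‖S ω + d ω‖ ∂μ ≤ (∫ ω, Real.cosh ‖S ω‖ ∂μ) * Real.cosh c := by
  set W : Ω → E := fun ω => (Real.sinh ‖S ω‖ * Real.sinh c / (‖S ω‖ * c)) • S ω
  have hW : StronglyMeasurable[m] W :=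
    (((Real.continuous_sinh.comp_stronglyMeasurable hS.norm).mul_const _).div
      (hS.norm.mul_const c)).smul hS
  have hWd : Integrable (fun ω => ⟪W ω, d ω⟫_ℝ) μ := by
    refine (hSi.mul_const (Real.sinh c)).mono' ((hW.mono hm).aestronglyMeasurable.inner
      hd.aestronglyMeasurable) ?_
    filter_upwards [hdc] with ω hω
    exact (abs_inner_sinh_smul_le (S ω) hω).trans <| mul_le_mul_of_nonneg_right
      (Real.sinh_lt_cosh _).le (Real.sinh_nonneg_iff.2 ((norm_nonneg _).trans hω))
  have hle : ∀ᵐ ω ∂μ, Real.cosh ‖S ω + d ω‖ ≤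
      Real.cosh ‖S ω‖ * Real.cosh c + ⟪W ω, d ω⟫_ℝ := by
    filter_upwards [hdc] with ω hω using cosh_norm_add_le (S ω) hω
  have hmaj := (hSi.mul_const (Real.cosh c)).add hWd
  have hint : Integrable (fun ω => Real.cosh ‖S ω + d ω‖) μ := by
    refine hmaj.mono' (Real.continuous_cosh.comp_aestronglyMeasurable
      ((hS.mono hm).aestronglyMeasurable.add hd.aestronglyMeasurable).norm) ?_
    simpa only [Real.norm_of_nonneg (Real.cosh_pos _).le, Pi.add_apply] using hle
  refine ⟨hint, (integral_mono_ae hint hmaj hle).trans_eq ?_⟩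
  rw [integral_add' (hSi.mul_const _) hWd, integral_mul_const,
    integral_inner_eq_zero_of_condExp_eq_zero hm hW hWd hd h0, add_zero]

variable [IsProbabilityMeasure μ] {ℱ : Filtration ℕ mΩ} {S : ℕ → Ω → E}

lemma integral_cosh_norm_le_of_martingale {c : ℕ → ℝ} (hS : Martingale S ℱ μ) (hS0 : S 0 = 0)
    (hc : ∀ n, ∀ᵐ ω ∂μ, ‖S (n + 1) ω - S n ω‖ ≤ c n) (n : ℕ) :
    Integrable (fun ω => Real.cosh ‖S n ω‖) μ ∧
      ∫ ω, Real.cosh ‖S n ω‖ ∂μ ≤ Real.exp ((∑ i ∈ Finset.range n, c i ^ 2) / 2) := by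
  induction n with
  | zero => simp [hS0]
  | succ n ih =>
    have h0 : μ[S (n + 1) - S n | ℱ n] =ᵐ[μ] 0 := by
      filter_upwards [condExp_sub (hS.integrable (n + 1)) (hS.integrable n) (ℱ n),
        hS.condExp_ae_eq n.le_succ, hS.condExp_ae_eq le_rfl] with ω hsub hsucc hself
      rw [hsub, Pi.sub_apply, hsucc, hself, sub_self, Pi.zero_apply]
    obtain ⟨hint, hle⟩ := integral_cosh_norm_add_le (ℱ.le n) (hS.stronglyAdapted n) ih.1
      ((hS.integrable (n + 1)).sub (hS.integrable n)) (hc n) h0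
    simp only [Pi.sub_apply, add_sub_cancel] at hint hle
    refine ⟨hint, hle.trans ?_⟩
    rw [Finset.sum_range_succ, add_div, Real.exp_add]
    gcongr
    exacts [ih.2, Real.cosh_le_exp_half_sq _]

theorem measureReal_norm_ge_le_of_martingale {c : ℕ → ℝ} (hS : Martingale S ℱ μ) (hS0 : S 0 = 0)
    (hc : ∀ n, ∀ᵐ ω ∂μ, ‖S (n + 1) ω - S n ω‖ ≤ c n) (n : ℕ) {r : ℝ} (hr : 0 ≤ r) :
    μ.real {ω | r ≤ ‖S n ω‖} ≤ 2 * Real.exp (-r ^ 2 / (2 * ∑ i ∈ Finset.range n, c i ^ 2)) := by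
  set V := ∑ i ∈ Finset.range n, c i ^ 2
  have hV0 : 0 ≤ V := Finset.sum_nonneg fun i _ => sq_nonneg (c i)
  set l : ℝ := r / V with hl
  have hl0 : 0 ≤ l := div_nonneg hr hV0
  have hlc (k : ℕ) : ∀ᵐ ω ∂μ, ‖(l • S) (k + 1) ω - (l • S) k ω‖ ≤ l * c k := by
    filter_upwards [hc k] with ω hω
    rw [Pi.smul_apply, Pi.smul_apply, Pi.smul_apply, Pi.smul_apply, ← smul_sub, norm_smul,
      Real.norm_of_nonneg hl0]
    gcongr
  obtain ⟨hint, hle⟩ := integral_cosh_norm_le_of_martingale (hS.smul l)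
    (by rw [Pi.smul_apply, hS0, smul_zero]) hlc n
  have hsub : {ω | r ≤ ‖S n ω‖} ⊆ {ω | Real.exp (l * r) / 2 ≤ Real.cosh ‖(l • S) n ω‖} := by
    intro ω (hω : r ≤ ‖S n ω‖)
    rw [Set.mem_ofPred_eq, Pi.smul_apply, Pi.smul_apply, norm_smul, Real.norm_of_nonneg hl0,
      Real.cosh_eq]
    gcongr
    exact (Real.exp_le_exp.2 (by gcongr)).trans (le_add_of_nonneg_right (Real.exp_pos _).le)
  have hmarkov : Real.exp (l * r) / 2 * μ.real {ω | r ≤ ‖S n ω‖} ≤ Real.exp (l ^ 2 * V / 2) :=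
    calc _ ≤ Real.exp (l * r) / 2 *
          μ.real {ω | Real.exp (l * r) / 2 ≤ Real.cosh ‖(l • S) n ω‖} :=
          mul_le_mul_of_nonneg_left (measureReal_mono hsub) (by positivity)
      _ ≤ ∫ ω, Real.cosh ‖(l • S) n ω‖ ∂μ :=
          mul_meas_ge_le_integral_of_nonneg (ae_of_all _ fun ω => (Real.cosh_pos _).le) hint _
      _ ≤ _ := by simpa only [mul_pow, ← Finset.mul_sum] using hle
  have hexp : l ^ 2 * V / 2 - l * r = -r ^ 2 / (2 * V) := by
    rcases hV0.eq_or_lt with h | h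
    · simp [hl, ← h]
    · rw [hl]
      field_simp
      ring
  rw [← hexp, Real.exp_sub, ← mul_div_assoc, le_div_iff₀ (Real.exp_pos _)]
  linarith

theorem ae_isBigO_sqrt_mul_log_of_martingale {c : ℝ} (hS : Martingale S ℱ μ) (hS0 : S 0 = 0)
    (hc : ∀ n, ∀ᵐ ω ∂μ, ‖S (n + 1) ω - S n ω‖ ≤ c) :
    ∀ᵐ ω ∂μ, (fun n => S n ω) =O[atTop] fun n : ℕ => √(n * Real.log n) := by
  set r : ℕ → ℝ := fun n => 2 * (|c| + 1) * √(n * Real.log n) with hr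
  have hc' (n : ℕ) : ∀ᵐ ω ∂μ, ‖S (n + 1) ω - S n ω‖ ≤ |c| + 1 := by
    filter_upwards [hc n] with ω hω using hω.trans ((le_abs_self c).trans (by linarith))
  have htail (n : ℕ) : μ.real {ω | r (n + 1) ≤ ‖S (n + 1) ω‖} ≤
      2 * (1 / ((n + 1 : ℕ) : ℝ) ^ 2) := by
    refine (measureReal_norm_ge_le_of_martingale hS hS0 hc' (n + 1) (by positivity)).trans_eq ?_
    have hn : (0 : ℝ) < (n + 1 : ℕ) := by positivity
    have hexp : -r (n + 1) ^ 2 / (2 * ∑ _i ∈ Finset.range (n + 1), (|c| + 1) ^ 2) =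
        -Real.log (((n + 1 : ℕ) : ℝ) ^ 2) := by
      rw [hr, mul_pow, Real.sq_sqrt (mul_nonneg hn.le (Real.log_natCast_nonneg _)),
        Finset.sum_const, Finset.card_range, nsmul_eq_mul, Real.log_pow]
      field_simp
      push_cast
      ring
    rw [hexp, Real.exp_neg, Real.exp_log (by positivity), one_div]
  have hsum : ∑' n, μ {ω | r (n + 1) ≤ ‖S (n + 1) ω‖} ≠ ⊤ := by
    have hsq := ((summable_nat_add_iff 1).2 (Real.summable_one_div_nat_pow.2 one_lt_two)).mul_left 2
    refine ne_top_of_le_ne_top hsq.tsum_ofReal_ne_top (ENNReal.tsum_le_tsum fun n => ?_)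
    rw [← ofReal_measureReal]
    exact ENNReal.ofReal_le_ofReal (htail n)
  filter_upwards [ae_eventually_notMem hsum] with ω hω
  refine IsBigO.of_bound (2 * (|c| + 1)) ?_
  filter_upwards [(eventually_ge_atTop 1).and (tendsto_sub_atTop_nat 1 |>.eventually hω)] with n hn
  rw [Nat.sub_add_cancel hn.1] at hn
  simpa only [hr, Set.mem_ofPred_eq, not_le, Real.norm_of_nonneg (Real.sqrt_nonneg _)]
    using (not_le.1 hn.2).le

end Azuma

section StrongLaw

open ProbabilityTheory

variable {Ω : Type*} {mΩ : MeasurableSpace Ω} {μ : Measure Ω}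

lemma variance_sum_range_le [IsFiniteMeasure μ] {X : ℕ → Ω → ℝ} (hX : ∀ t, MemLp (X t) 2 μ)
    {a : ℕ → ℝ} (ha : Summable a) (hcov : ∀ n k, |cov[X n, X (n + k); μ]| ≤ a k) (n : ℕ) :
    Var[∑ t ∈ Finset.range n, X t; μ] ≤ 2 * (∑' k, a k) * n := by
  have ha0 (k : ℕ) : 0 ≤ a k := (abs_nonneg _).trans (hcov 0 k)
  induction n with
  | zero => simp
  | succ n ih =>
    have hvar : Var[X n; μ] ≤ a 0 := by
      rw [← covariance_self (hX n).aemeasurable]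
      exact (le_abs_self _).trans (hcov n 0)
    have hcross : cov[∑ t ∈ Finset.range n, X t, X n; μ] ≤ ∑ k ∈ Finset.range n, a (k + 1) := by
      rw [covariance_sum_left' (fun t _ => hX t) (hX n),
        ← Finset.sum_range_reflect fun k => a (k + 1)]
      refine Finset.sum_le_sum fun t ht => ?_
      have ht' := Finset.mem_range.1 ht
      have h := (le_abs_self _).trans (hcov t (n - t))
      rwa [Nat.add_sub_cancel' ht'.le, show n - t = n - 1 - t + 1 by omega] at h
    have hpartial : ∑ k ∈ Finset.range n, a (k + 1) + a 0 ≤ ∑' k, a k := by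
      rw [← Finset.sum_range_succ']
      exact ha.sum_le_tsum _ fun k _ => ha0 k
    rw [Finset.sum_range_succ, variance_add (memLp_finsetSum' _ fun t _ => hX t) (hX n)]
    push_cast
    linarith [ha0 0]

lemma ae_tendsto_zero_of_summable_integral {Y : ℕ → Ω → ℝ} (hY : ∀ n, Integrable (Y n) μ)
    (hY0 : ∀ n, 0 ≤ᵐ[μ] Y n) (hsum : Summable fun n => ∫ ω, Y n ω ∂μ) :
    ∀ᵐ ω ∂μ, Tendsto (fun n => Y n ω) atTop (𝓝 0) := by
  have hlin (n : ℕ) : ∫⁻ ω, ENNReal.ofReal (Y n ω) ∂μ = ENNReal.ofReal (∫ ω, Y n ω ∂μ) :=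
    (ofReal_integral_eq_lintegral_ofReal (hY n) (hY0 n)).symm
  have hmeas (n : ℕ) : AEMeasurable (fun ω => ENNReal.ofReal (Y n ω)) μ :=
    (hY n).aemeasurable.ennreal_ofReal
  have hfin : ∫⁻ ω, ∑' n, ENNReal.ofReal (Y n ω) ∂μ ≠ ⊤ := by
    rw [lintegral_tsum hmeas]
    simpa only [hlin] using hsum.tsum_ofReal_ne_top
  filter_upwards [ae_lt_top' (AEMeasurable.tsum hmeas) hfin, ae_all_iff.2 hY0]
    with ω hω hω0
  have h := (ENNReal.tendsto_toReal ENNReal.zero_ne_top).comp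
    (ENNReal.tendsto_atTop_zero_of_tsum_ne_top hω.ne)
  simpa only [Function.comp_def, ENNReal.toReal_ofReal (hω0 _), ENNReal.toReal_zero] using h

variable {E : Type*} [NormedAddCommGroup E] [NormedSpace ℝ E]

lemma norm_average_le_norm_average_sqrt_sq {x : ℕ → E} {M : ℝ} (hM : ∀ t, ‖x t‖ ≤ M) (n : ℕ) :
    ‖(n : ℝ)⁻¹ • ∑ t ∈ Finset.range n, x t‖ ≤
      ‖((n.sqrt ^ 2 : ℕ) : ℝ)⁻¹ • ∑ t ∈ Finset.range (n.sqrt ^ 2), x t‖ +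
        2 * M * (n.sqrt : ℝ)⁻¹ := by
  rcases n.eq_zero_or_pos with rfl | hn
  · simp
  set m := n.sqrt with hm
  have hm0 : (0 : ℝ) < m := by exact_mod_cast Nat.sqrt_pos.2 hn
  have hM0 : 0 ≤ M := (norm_nonneg _).trans (hM 0)
  have hmn : m ^ 2 ≤ n := Nat.sqrt_le' n
  have hnm : n - m ^ 2 ≤ 2 * m := by
    have h := Nat.sqrt_le_add n
    rw [← hm] at h
    lia
  have hrest : ‖∑ t ∈ Finset.Ico (m ^ 2) n, x t‖ ≤ 2 * M * m := by
    refine (norm_sum_le_of_le _ fun t _ => hM t).trans ?_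
    rw [Finset.sum_const, Nat.card_Ico, nsmul_eq_mul, mul_right_comm]
    gcongr
    exact_mod_cast hnm
  have hsum : ‖∑ t ∈ Finset.range n, x t‖ ≤ ‖∑ t ∈ Finset.range (m ^ 2), x t‖ + 2 * M * m := by
    rw [← Finset.sum_range_add_sum_Ico _ hmn]
    exact (norm_add_le _ _).trans (by gcongr)
  rw [norm_smul, norm_smul, norm_inv, norm_inv, Real.norm_natCast, Real.norm_natCast]
  calc (n : ℝ)⁻¹ * ‖∑ t ∈ Finset.range n, x t‖
      ≤ ((m ^ 2 : ℕ) : ℝ)⁻¹ * (‖∑ t ∈ Finset.range (m ^ 2), x t‖ + 2 * M * m) := by gcongr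
    _ = ((m ^ 2 : ℕ) : ℝ)⁻¹ * ‖∑ t ∈ Finset.range (m ^ 2), x t‖ + 2 * M * (m : ℝ)⁻¹ := by
        push_cast
        field_simp

lemma tendsto_average_zero_of_tendsto_average_sq {x : ℕ → E} {M : ℝ} (hM : ∀ t, ‖x t‖ ≤ M)
    (hx : Tendsto (fun m : ℕ => ((m ^ 2 : ℕ) : ℝ)⁻¹ • ∑ t ∈ Finset.range (m ^ 2), x t) atTop
      (𝓝 0)) :
    Tendsto (fun n : ℕ => (n : ℝ)⁻¹ • ∑ t ∈ Finset.range n, x t) atTop (𝓝 0) := by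
  have hsqrt : Tendsto Nat.sqrt atTop atTop :=
    tendsto_atTop_atTop.2 fun m => ⟨m ^ 2, fun n hn => Nat.le_sqrt'.2 hn⟩
  have hbound := (hx.norm.comp hsqrt).add
    ((tendsto_inv_atTop_nhds_zero_nat.comp hsqrt).const_mul (2 * M))
  rw [norm_zero, mul_zero, add_zero] at hbound
  exact squeeze_zero_norm (norm_average_le_norm_average_sqrt_sq hM) hbound

lemma ae_tendsto_average_zero_of_integral_sq_le [IsFiniteMeasure μ] {X : ℕ → Ω → E}
    (hX : ∀ t, AEStronglyMeasurable (X t) μ) {M : ℝ} (hM : ∀ t, ∀ᵐ ω ∂μ, ‖X t ω‖ ≤ M) {K : ℝ}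
    (hK : ∀ n : ℕ, ∫ ω, ‖∑ t ∈ Finset.range n, X t ω‖ ^ 2 ∂μ ≤ K * n) :
    ∀ᵐ ω ∂μ, Tendsto (fun n : ℕ => (n : ℝ)⁻¹ • ∑ t ∈ Finset.range n, X t ω) atTop (𝓝 0) := by
  set Y : ℕ → Ω → ℝ :=
    fun m ω => ‖((m ^ 2 : ℕ) : ℝ)⁻¹ • ∑ t ∈ Finset.range (m ^ 2), X t ω‖ ^ 2 with hY_def
  have hL2 (n : ℕ) : MemLp (fun ω => ∑ t ∈ Finset.range n, X t ω) 2 μ :=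
    memLp_finsetSum _ fun t _ => MemLp.of_bound (hX t) M (hM t)
  have hY (m : ℕ) : Integrable (Y m) μ :=
    ((hL2 (m ^ 2)).const_smul _).integrable_norm_pow two_ne_zero
  have hYle (m : ℕ) : ∫ ω, Y m ω ∂μ ≤ K * (1 / (m : ℝ) ^ 2) := by
    simp only [hY_def, norm_smul, mul_pow, integral_const_mul]
    refine (mul_le_mul_of_nonneg_left (hK (m ^ 2)) (by positivity)).trans_eq ?_
    rw [norm_inv, Real.norm_natCast]
    push_cast
    rcases eq_or_ne (m : ℝ) 0 with hm | hm
    · simp [hm]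
    · field_simp
  have hsum : Summable fun m => ∫ ω, Y m ω ∂μ :=
    .of_nonneg_of_le (fun m => integral_nonneg fun ω => sq_nonneg _) hYle
      ((Real.summable_one_div_nat_pow.2 one_lt_two).mul_left K)
  filter_upwards [ae_tendsto_zero_of_summable_integral hY
    (fun m => ae_of_all _ fun ω => sq_nonneg _) hsum, ae_all_iff.2 hM] with ω hω hMω
  refine tendsto_average_zero_of_tendsto_average_sq hMω (tendsto_zero_iff_norm_tendsto_zero.2 ?_)
  simpa only [Function.comp_def, hY_def, Real.sqrt_sq (norm_nonneg _), Real.sqrt_zero]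
    using (Real.continuous_sqrt.tendsto 0).comp hω

lemma covariance_indicator_one [IsProbabilityMeasure μ] {A B : Set Ω} (hA : MeasurableSet A)
    (hB : MeasurableSet B) :
    cov[A.indicator (1 : Ω → ℝ), B.indicator 1; μ] = μ.real (A ∩ B) - μ.real A * μ.real B := by
  have hL2 {D : Set Ω} (hD : MeasurableSet D) : MemLp (D.indicator (1 : Ω → ℝ)) 2 μ :=
    (memLp_const (1 : ℝ)).indicator hD
  rw [covariance_eq_sub (hL2 hA) (hL2 hB), ← Set.inter_indicator_one,
    integral_indicator_one (hA.inter hB), integral_indicator_one hA, integral_indicator_one hB]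

variable [IsProbabilityMeasure μ]

theorem ae_tendsto_relative_frequency {A : ℕ → Set Ω} (hA : ∀ t, MeasurableSet (A t)) {p : ℝ}
    (hp : ∀ t, μ.real (A t) = p) {a : ℕ → ℝ} (ha : Summable a)
    (hcov : ∀ n k, |μ.real (A n ∩ A (n + k)) - μ.real (A n) * μ.real (A (n + k))| ≤ a k) :
    ∀ᵐ ω ∂μ, Tendsto
      (fun n : ℕ => (n : ℝ)⁻¹ * ∑ t ∈ Finset.range n, (A t).indicator (1 : Ω → ℝ) ω) atTop
      (𝓝 p) := by
  have hL2 (t : ℕ) : MemLp ((A t).indicator (1 : Ω → ℝ)) 2 μ :=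
    (memLp_const (1 : ℝ)).indicator (hA t)
  have hbound (t : ℕ) (ω : Ω) : ‖(A t).indicator (1 : Ω → ℝ) ω - p‖ ≤ 1 + |p| :=
    (norm_sub_le _ _).trans <| add_le_add_left
      ((norm_indicator_le_norm_self _ _).trans_eq (by simp)) _
  have hvar (n : ℕ) : ∫ ω, ‖∑ t ∈ Finset.range n, ((A t).indicator (1 : Ω → ℝ) ω - p)‖ ^ 2 ∂μ ≤
      2 * (∑' k, a k) * n := by
    refine Eq.trans_le ?_ (variance_sum_range_le hL2 ha
      (fun n k => by rw [covariance_indicator_one (hA n) (hA _)]; exact hcov n k) n)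
    have hmean : ∫ ω, (∑ t ∈ Finset.range n, (A t).indicator (1 : Ω → ℝ)) ω ∂μ = n * p := by
      simp only [Finset.sum_apply]
      rw [integral_finsetSum _ fun t _ => (hL2 t).integrable one_le_two]
      simp [integral_indicator_one (hA _), hp]
    rw [variance_eq_integral (memLp_finsetSum' _ fun t _ => hL2 t).aemeasurable, hmean]
    simp [Finset.sum_sub_distrib]
  filter_upwards [ae_tendsto_average_zero_of_integral_sq_le
    (fun t => ((hL2 t).sub (memLp_const p)).aestronglyMeasurable)
    (fun t => ae_of_all _ (hbound t)) hvar] with ω hω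
  have hshift := hω.add_const p
  rw [zero_add] at hshift
  refine hshift.congr' ?_
  filter_upwards [eventually_ne_atTop 0] with n hn
  have hn0 : (n : ℝ) ≠ 0 := Nat.cast_ne_zero.2 hn
  simp only [Pi.sub_apply]
  rw [Finset.sum_sub_distrib, Finset.sum_const, Finset.card_range, nsmul_eq_mul, smul_eq_mul,
    mul_sub, inv_mul_cancel_left₀ hn0, sub_add_cancel]

end StrongLaw

section MixingStrongLaw

variable {S E : Type*} [MeasurableSpace S] [NormedAddCommGroup E] [NormedSpace ℝ E]

lemma exists_simpleFunc_norm_sub_le {ν : Measure S} [IsFiniteMeasure ν] {g : S → E}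
    (hg : StronglyMeasurable g) {M : ℝ} (hM : ∀ᵐ s ∂ν, ‖g s‖ ≤ M) {ε : ℝ} (hε : 0 < ε) :
    ∃ (G : SimpleFunc S E) (h : SimpleFunc S ℝ),
      (∀ᵐ s ∂ν, ‖g s - G s‖ ≤ h s) ∧ ∫ s, h s ∂ν ≤ ε := by
  classical
  set η : ℝ := ε / (ν.real Set.univ + 2 * |M| + 1) with hη_def
  have hden : 0 < ν.real Set.univ + 2 * |M| + 1 := by positivity
  have hη : 0 < η := div_pos hε hden
  have hM' : ∀ᵐ s ∂ν, ‖g s‖ ≤ |M| := hM.mono fun s hs => hs.trans (le_abs_self M)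
  obtain ⟨B, hB, hνB, hunif⟩ := tendstoUniformlyOn_of_ae_tendsto'
    (fun k => (hg.approxBounded |M| k).stronglyMeasurable) hg
    (hg.tendsto_approxBounded_ae hM') hη
  obtain ⟨k, hk⟩ := (Metric.tendstoUniformlyOn_iff.1 hunif η hη).exists
  refine ⟨hg.approxBounded |M| k,
    .piecewise B hB (.const S (2 * |M|)) (.const S η), ?_, ?_⟩
  · filter_upwards [hM'] with s hs
    have hGs : ‖hg.approxBounded |M| k s‖ ≤ |M| := hg.norm_approxBounded_le (abs_nonneg M) k s
    by_cases hsB : s ∈ B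
    · simpa [hsB, two_mul] using (norm_sub_le _ _).trans (add_le_add hs hGs)
    · simpa [hsB, dist_eq_norm] using (hk s hsB).le
  · rw [SimpleFunc.coe_piecewise, integral_piecewise hB
      (SimpleFunc.integrable_of_isFiniteMeasure _).integrableOn
      (SimpleFunc.integrable_of_isFiniteMeasure _).integrableOn]
    have hνB' : ν.real B ≤ η := ENNReal.toReal_le_of_le_ofReal hη.le hνB
    have hνBc : ν.real Bᶜ ≤ ν.real Set.univ := measureReal_mono (Set.subset_univ _)
    simp only [SimpleFunc.const_apply, setIntegral_const, smul_eq_mul]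
    calc ν.real B * (2 * |M|) + ν.real Bᶜ * η
        ≤ η * (2 * |M|) + ν.real Set.univ * η + η := by
          linarith [mul_le_mul_of_nonneg_right hνB' (by positivity : 0 ≤ 2 * |M|),
            mul_le_mul_of_nonneg_right hνBc hη.le]
      _ = ε := by rw [hη_def]; field_simp; ring

lemma tendsto_average_of_approx {ν : Measure S} [IsFiniteMeasure ν] {g : S → E}
    (hg : Integrable g ν) {v : ℕ → S} {G : ℕ → SimpleFunc S E} {h : ℕ → SimpleFunc S ℝ}
    (hGh : ∀ j, ∀ᵐ s ∂ν, ‖g s - G j s‖ ≤ h j s) (hv : ∀ j t, ‖g (v t) - G j (v t)‖ ≤ h j (v t))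
    (hh : Tendsto (fun j => ∫ s, h j s ∂ν) atTop (𝓝 0))
    (hGlim : ∀ j, Tendsto (fun n : ℕ => (n : ℝ)⁻¹ • ∑ t ∈ Finset.range n, G j (v t)) atTop
      (𝓝 (∫ s, G j s ∂ν)))
    (hhlim : ∀ j, Tendsto (fun n : ℕ => (n : ℝ)⁻¹ • ∑ t ∈ Finset.range n, h j (v t)) atTop
      (𝓝 (∫ s, h j s ∂ν))) :
    Tendsto (fun n : ℕ => (n : ℝ)⁻¹ • ∑ t ∈ Finset.range n, g (v t)) atTop (𝓝 (∫ s, g s ∂ν)) := by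
  have hint (j : ℕ) : ‖∫ s, G j s ∂ν - ∫ s, g s ∂ν‖ ≤ ∫ s, h j s ∂ν := by
    rw [← integral_sub (G j).integrable_of_isFiniteMeasure hg]
    refine norm_integral_le_of_norm_le (h j).integrable_of_isFiniteMeasure ?_
    simpa only [norm_sub_rev] using hGh j
  have havg (j n : ℕ) : ‖(n : ℝ)⁻¹ • ∑ t ∈ Finset.range n, g (v t) -
      (n : ℝ)⁻¹ • ∑ t ∈ Finset.range n, G j (v t)‖ ≤
        (n : ℝ)⁻¹ • ∑ t ∈ Finset.range n, h j (v t) := by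
    rw [← smul_sub, ← Finset.sum_sub_distrib, norm_smul, norm_inv, Real.norm_natCast, smul_eq_mul]
    gcongr
    exact norm_sum_le_of_le _ fun t _ => hv j t
  rw [tendsto_iff_norm_sub_tendsto_zero, Metric.tendsto_nhds]
  intro ε hε
  obtain ⟨j, hj⟩ := (hh.eventually_lt_const (by positivity : (0 : ℝ) < ε / 3)).exists
  have hGj := tendsto_iff_norm_sub_tendsto_zero.1 (hGlim j)
  filter_upwards [hGj.eventually_lt_const (by positivity : (0 : ℝ) < ε / 3),
    (hhlim j).eventually_lt_const hj] with n hGn hhn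
  rw [Real.dist_0_eq_abs, abs_norm]
  have htri := norm_add₃_le
    (a := (n : ℝ)⁻¹ • ∑ t ∈ Finset.range n, g (v t) - (n : ℝ)⁻¹ • ∑ t ∈ Finset.range n, G j (v t))
    (b := (n : ℝ)⁻¹ • ∑ t ∈ Finset.range n, G j (v t) - ∫ s, G j s ∂ν)
    (c := ∫ s, G j s ∂ν - ∫ s, g s ∂ν)
  simp only [sub_add_sub_cancel] at htri
  linarith [havg j n, hint j]

variable {Ω : Type*} {mΩ : MeasurableSpace Ω} {μ : Measure Ω} {w : ℕ → Ω → S}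

lemma StrictlyStationary.map_eq (hst : StrictlyStationary μ w) (hw : ∀ t, Measurable (w t))
    (t : ℕ) : μ.map (w t) = μ.map (w 0) := by
  have h := congrArg (Measure.map fun v : ℕ → S => v 0) (hst t)
  rw [Measure.map_map (measurable_pi_apply 0) (measurable_pi_lambda _ fun s => hw _),
    Measure.map_map (measurable_pi_apply 0) (measurable_pi_lambda _ fun s => hw _)] at h
  simpa only [Function.comp_def, zero_add] using h

variable [IsProbabilityMeasure μ]

lemma GeometricallyStronglyMixing.exists_summable_abs_cov_le
    (hmix : GeometricallyStronglyMixing μ w) {B : Set S} (hB : MeasurableSet B) :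
    ∃ a : ℕ → ℝ, Summable a ∧ ∀ n k : ℕ,
      |μ.real (w n ⁻¹' B ∩ w (n + k) ⁻¹' B) - μ.real (w n ⁻¹' B) * μ.real (w (n + k) ⁻¹' B)| ≤
        a k := by
  obtain ⟨c, r, hr0, hr1, h⟩ := hmix
  refine ⟨fun k => max c 1 * r ^ k, (summable_geometric_of_lt_one hr0.le hr1).mul_left _,
    fun n k => ?_⟩
  rcases k.eq_zero_or_pos with rfl | hk
  · have hle : μ.real (w n ⁻¹' B) ≤ 1 := measureReal_le_one
    have hnonneg : 0 ≤ μ.real (w n ⁻¹' B) := measureReal_nonneg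
    simp only [add_zero, Set.inter_self, pow_zero, mul_one]
    exact (abs_le.2 ⟨by nlinarith, by nlinarith⟩).trans (le_max_right c 1)
  · refine (h k n hk _ _ ?_ ?_).trans
      (mul_le_mul_of_nonneg_right (le_max_left c 1) (by positivity))
    · exact le_iSup₂ (f := fun s (_ : s ≤ n) => MeasurableSpace.comap (w s) inferInstance)
        n le_rfl _ ⟨B, hB, rfl⟩
    · exact le_iSup₂ (f := fun s (_ : s ≥ n + k) => MeasurableSpace.comap (w s) inferInstance)
        (n + k) le_rfl _ ⟨B, hB, rfl⟩

lemma ae_tendsto_average_indicator (hw : ∀ t, Measurable (w t)) (hst : StrictlyStationary μ w)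
    (hmix : GeometricallyStronglyMixing μ w) {B : Set S} (hB : MeasurableSet B) :
    ∀ᵐ ω ∂μ, Tendsto
      (fun n : ℕ => (n : ℝ)⁻¹ * ∑ t ∈ Finset.range n, B.indicator (1 : S → ℝ) (w t ω)) atTop
      (𝓝 ((μ.map (w 0)).real B)) := by
  obtain ⟨a, ha, hcov⟩ := hmix.exists_summable_abs_cov_le hB
  have hp (t : ℕ) : μ.real (w t ⁻¹' B) = (μ.map (w 0)).real B := by
    rw [← hst.map_eq hw t, map_measureReal_apply (hw t) hB]
  exact ae_tendsto_relative_frequency (fun t => hw t hB) hp ha hcov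

lemma ae_tendsto_average_simpleFunc [CompleteSpace E] (hw : ∀ t, Measurable (w t))
    (hst : StrictlyStationary μ w) (hmix : GeometricallyStronglyMixing μ w) (G : SimpleFunc S E) :
    ∀ᵐ ω ∂μ, Tendsto (fun n : ℕ => (n : ℝ)⁻¹ • ∑ t ∈ Finset.range n, G (w t ω)) atTop
      (𝓝 (∫ s, G s ∂μ.map (w 0))) := by
  have hfreq : ∀ᵐ ω ∂μ, ∀ y ∈ G.range, Tendsto (fun n : ℕ => (n : ℝ)⁻¹ *
      ∑ t ∈ Finset.range n, (G ⁻¹' {y}).indicator (1 : S → ℝ) (w t ω)) atTop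
      (𝓝 ((μ.map (w 0)).real (G ⁻¹' {y}))) :=
    (eventually_all_finset _).2 fun y _ =>
      ae_tendsto_average_indicator hw hst hmix (G.measurableSet_preimage _)
  have hG (s : S) : ∑ y ∈ G.range, (G ⁻¹' {y}).indicator (1 : S → ℝ) s • y = G s := by
    rw [Finset.sum_eq_single_of_mem (G s) (G.mem_range_self s)]
    · simp
    · intro y _ hy
      rw [Set.indicator_of_notMem (by simpa using hy.symm), zero_smul]
  filter_upwards [hfreq] with ω hω
  rw [← SimpleFunc.integral_eq_integral _ G.integrable_of_isFiniteMeasure, SimpleFunc.integral_eq]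
  refine (tendsto_finsetSum _ fun y hy => (hω y hy).smul_const y).congr fun n => ?_
  simp only [mul_smul, ← Finset.smul_sum, Finset.sum_smul]
  rw [Finset.sum_comm]
  simp only [hG]

theorem ae_tendsto_average [CompleteSpace E] (hw : ∀ t, Measurable (w t))
    (hst : StrictlyStationary μ w) (hmix : GeometricallyStronglyMixing μ w) {g : S → E}
    (hg : StronglyMeasurable g) {M : ℝ} (hM : ∀ᵐ s ∂μ.map (w 0), ‖g s‖ ≤ M) :
    ∀ᵐ ω ∂μ, Tendsto (fun n : ℕ => (n : ℝ)⁻¹ • ∑ t ∈ Finset.range n, g (w t ω)) atTop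
      (𝓝 (∫ s, g s ∂μ.map (w 0))) := by
  choose G h hGh hh using fun j : ℕ =>
    exists_simpleFunc_norm_sub_le hg hM (Nat.one_div_pos_of_nat (α := ℝ) (n := j))
  have hh0 (j : ℕ) : 0 ≤ ∫ s, h j s ∂μ.map (w 0) :=
    integral_nonneg_of_ae <| (hGh j).mono fun s hs => (norm_nonneg _).trans hs
  have hpath : ∀ᵐ ω ∂μ, ∀ j t, ‖g (w t ω) - G j (w t ω)‖ ≤ h j (w t ω) :=
    ae_all_iff.2 fun j => ae_all_iff.2 fun t =>
      ae_of_ae_map (hw t).aemeasurable (by rw [hst.map_eq hw t]; exact hGh j)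
  filter_upwards [hpath, ae_all_iff.2 fun j => ae_tendsto_average_simpleFunc hw hst hmix (G j),
    ae_all_iff.2 fun j => ae_tendsto_average_simpleFunc hw hst hmix (h j)] with ω hω hGω hhω
  exact tendsto_average_of_approx (.of_bound hg.aestronglyMeasurable M hM) hGh hω
    (squeeze_zero hh0 hh tendsto_one_div_add_atTop_nhds_zero_nat) hGω hhω

end MixingStrongLaw

section Tensor

variable {E F : Type*} [NormedAddCommGroup E] [InnerProductSpace ℝ E]
  [NormedAddCommGroup F] [InnerProductSpace ℝ F]

@[simp]
lemma tensor_apply (a v : E) (b : F) : tensor a b v = ⟪a, v⟫_ℝ • b := by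
  simp [tensor]

lemma norm_tensor (a : E) (b : F) : ‖tensor a b‖ = ‖a‖ * ‖b‖ := by
  rw [tensor, InnerProductSpace.norm_rankOne, mul_comm]

lemma continuous_tensor : Continuous fun p : E × F => tensor p.1 p.2 :=
  (InnerProductSpace.rankOne ℝ (E := F) (F := E)).continuous₂.comp continuous_swap

lemma isCompactOperator_tensor (a : E) (b : F) : IsCompactOperator (tensor a b) := by
  rw [tensor, InnerProductSpace.rankOne_def']
  exact (isCompactOperator_of_locallyCompactSpace_dom (innerSL ℝ a)).clm_comp
    (ContinuousLinearMap.toSpanSingleton ℝ b)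

end Tensor

section HilbertSchmidtOperators

variable {H : Type*} [NormedAddCommGroup H] [InnerProductSpace ℝ H] [CompleteSpace H]

namespace HilbertSchmidt

lemma inner_tensorHS_left (a b : H) (T : HilbertSchmidt H) :
    ⟪tensorHS a b, T⟫_ℝ = ⟪b, T.toCLM a⟫_ℝ := by
  have hcoord (i : basisIndex H) : ⟪toL2 (tensorHS a b) i, toL2 T i⟫_ℝ =
      ⟪a, stdBasis H i⟫_ℝ * ⟪stdBasis H i, T.toCLM.adjoint b⟫_ℝ := by
    change ⟪tensor a b (stdBasis H i), T.toCLM (stdBasis H i)⟫_ℝ = _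
    rw [tensor_apply, real_inner_smul_left, ContinuousLinearMap.adjoint_inner_right,
      real_inner_comm b]
  have hsum := lp.hasSum_inner (𝕜 := ℝ) (toL2 (tensorHS a b)) (toL2 T)
  simp only [hcoord] at hsum
  refine (hsum.unique ((stdBasis H).hasSum_inner_mul_inner a _)).trans ?_
  rw [ContinuousLinearMap.adjoint_inner_right, real_inner_comm]

lemma norm_tensorHS (a b : H) : ‖tensorHS a b‖ = ‖a‖ * ‖b‖ := by
  refine (sq_eq_sq₀ (norm_nonneg _) (by positivity)).1 ?_
  rw [← real_inner_self_eq_norm_sq, inner_tensorHS_left]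
  change ⟪b, tensor a b a⟫_ℝ = _
  rw [tensor_apply, real_inner_smul_right, real_inner_self_eq_norm_sq,
    real_inner_self_eq_norm_sq, mul_pow]

lemma norm_toCLM_le (T : HilbertSchmidt H) : ‖T.toCLM‖ ≤ ‖T‖ := by
  refine T.toCLM.opNorm_le_bound (norm_nonneg T) fun v => ?_
  have hCS : ‖T.toCLM v‖ * ‖T.toCLM v‖ ≤ ‖T‖ * ‖v‖ * ‖T.toCLM v‖ := by
    rw [← real_inner_self_eq_norm_mul_norm, ← inner_tensorHS_left]
    refine (real_inner_le_norm _ _).trans_eq ?_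
    rw [norm_tensorHS]
    ring
  rcases (norm_nonneg (T.toCLM v)).eq_or_lt with h0 | hpos
  · rw [← h0]
    exact mul_nonneg (norm_nonneg T) (norm_nonneg v)
  · exact le_of_mul_le_mul_right hCS hpos

/-- The inclusion of the Hilbert-Schmidt operators into the bounded operators, as a continuous
linear map. -/
noncomputable def toCLML : HilbertSchmidt H →L[ℝ] H →L[ℝ] H :=
  LinearMap.mkContinuous (hsSubmodule H).subtype 1 fun T => by
    rw [one_mul]
    exact norm_toCLM_le T

lemma hasSum_tensorHS (T : HilbertSchmidt H) :
    HasSum (fun i => tensorHS (stdBasis H i) (T.toCLM (stdBasis H i))) T := by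
  classical
  have hind : IsInducing (toL2 (H := H)) :=
    (AddMonoidHomClass.isometry_of_norm (toL2 (H := H)) fun _ => rfl).isUniformInducing.isInducing
  have hsingle (i : basisIndex H) : toL2 (tensorHS (stdBasis H i) (T.toCLM (stdBasis H i))) =
      lp.single 2 i (toL2 T i) := by
    ext j
    change tensor (stdBasis H i) (T.toCLM (stdBasis H i)) (stdBasis H j) = _
    rw [tensor_apply, orthonormal_iff_ite.1 (stdBasis H).orthonormal i j, lp.single_apply]
    rcases eq_or_ne i j with rfl | hij
    · rw [if_pos rfl, one_smul, Pi.single_eq_same]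
      rfl
    · rw [if_neg hij, zero_smul, Pi.single_eq_of_ne hij.symm]
  refine (hind.hasSum_iff _ _).1 ?_
  simpa only [Function.comp_def, hsingle] using lp.hasSum_single ENNReal.ofNat_ne_top (toL2 T)

end HilbertSchmidt

lemma IsHilbertSchmidt.isCompactOperator {T : H →L[ℝ] H} (hT : IsHilbertSchmidt T) :
    IsCompactOperator T := by
  have hsum : HasSum (fun i => tensor (stdBasis H i) (T (stdBasis H i))) T :=
    (HilbertSchmidt.hasSum_tensorHS ⟨T, hT⟩).mapL HilbertSchmidt.toCLML
  refine isCompactOperator_of_tendsto hsum (Eventually.of_forall fun s => ?_)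
  exact (compactOperator (RingHom.id ℝ) H H).sum_mem fun i _ => isCompactOperator_tensor _ _

/-- The tensor product `(a, b) ↦ a ⊗ b` as a continuous bilinear map into the Hilbert-Schmidt
operators. -/
noncomputable def tensorHSL : H →L[ℝ] H →L[ℝ] HilbertSchmidt H :=
  LinearMap.mkContinuous₂
    (LinearMap.mk₂ ℝ tensorHS
      (fun a b c => Subtype.ext (by
        ext v; change tensor (a + b) c v = tensor a c v + tensor b c v
        simp [inner_add_left, add_smul]))
      (fun r a b => Subtype.ext (by
        ext v; change tensor (r • a) b v = r • tensor a b v; simp [inner_smul_left, mul_smul]))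
      (fun a b c => Subtype.ext (by
        ext v; change tensor a (b + c) v = tensor a b v + tensor a c v; simp))
      (fun r a b => Subtype.ext (by
        ext v; change tensor a (r • b) v = r • tensor a b v; simp [smul_comm r])))
    1 fun a b => by
      rw [one_mul]
      exact (HilbertSchmidt.norm_tensorHS a b).le

@[simp]
lemma tensorHSL_apply (a b : H) : tensorHSL a b = tensorHS a b := rfl

lemma norm_sampleMoment_le {Ω : Type*} (X Y : ℕ → Ω → H) (T : ℕ) (ω : Ω) :
    ‖sampleMoment X Y T ω‖ ≤ ‖sampleMomentHS X Y T ω‖ := by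
  have h : (sampleMomentHS X Y T ω).toCLM = sampleMoment X Y T ω := by
    change HilbertSchmidt.toCLML (sampleMomentHS X Y T ω) = _
    rw [sampleMomentHS, map_smul, map_sum]
    rfl
  rw [← h]
  exact HilbertSchmidt.norm_toCLM_le _

end HilbertSchmidtOperators

section StrongConvergence

variable {E F G : Type*} [NormedAddCommGroup E] [NormedSpace ℝ E] [NormedAddCommGroup F]
  [NormedSpace ℝ F] [NormedAddCommGroup G] [NormedSpace ℝ G]
  {ι : Type*} {l : Filter ι} {Q : ι → F →L[ℝ] G} {M : ℝ}

lemma tendsto_apply_zero_of_denseRange {D : E →L[ℝ] F} (hD : DenseRange D)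
    (hQ : ∀ i, ‖Q i‖ ≤ M) (hQD : Tendsto (fun i => Q i ∘L D) l (𝓝 0)) (v : F) :
    Tendsto (fun i => Q i v) l (𝓝 0) := by
  rw [Metric.tendsto_nhds]
  intro ε hε
  obtain ⟨w, hw⟩ := hD.exists_dist_lt v (show 0 < ε / (2 * (|M| + 1)) by positivity)
  have hQw : Tendsto (fun i => Q i (D w)) l (𝓝 0) :=
    ((ContinuousLinearMap.apply ℝ G w).continuous.tendsto' 0 0 (map_zero _)).comp hQD
  filter_upwards [Metric.tendsto_nhds.1 hQw (ε / 2) (half_pos hε)] with i hi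
  have hdiff : dist (Q i v) (Q i (D w)) ≤ ε / 2 := by
    rw [dist_eq_norm, ← map_sub]
    calc ‖Q i (v - D w)‖ ≤ (|M| + 1) * (ε / (2 * (|M| + 1))) :=
          (Q i).le_of_opNorm_le_of_le ((hQ i).trans (by linarith [le_abs_self M]))
            (by simpa only [dist_eq_norm] using hw.le)
      _ = ε / 2 := by field_simp
  linarith [dist_triangle (Q i v) (Q i (D w)) 0]

lemma tendsto_comp_zero_of_isCompactOperator {K : E →L[ℝ] F} (hK : IsCompactOperator K)
    (hQ : ∀ i, ‖Q i‖ ≤ M) (hlim : ∀ v, Tendsto (fun i => Q i v) l (𝓝 0)) :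
    Tendsto (fun i => Q i ∘L K) l (𝓝 0) := by
  obtain ⟨S, hS, hKS⟩ := hK.image_subset_compact_of_bounded (f := K.toLinearMap)
    (Metric.isBounded_closedBall (x := 0) (r := 1))
  have hequi : UniformEquicontinuous fun i => ⇑(Q i) :=
    LipschitzWith.uniformEquicontinuous _ M.toNNReal fun i =>
      ContinuousLinearMap.lipschitzWith_of_opNorm_le ((hQ i).trans (Real.le_coe_toNNReal M))
  have hunif : TendstoUniformlyOn (fun i v => Q i v) 0 l S := by
    have hpi : Tendsto (Set.domRestrict (⋃₀ {S}) ∘ fun i => ⇑(Q i)) l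
        (𝓝 (Set.domRestrict (⋃₀ {S}) (0 : F → G))) := tendsto_pi_nhds.2 fun v => hlim v
    exact UniformOnFun.tendsto_iff_tendstoUniformlyOn.1
      ((EquicontinuousOn.tendsto_uniformOnFun_iff_pi' (by simpa using hS)
        (fun S _ => hequi.equicontinuous.equicontinuousOn S) l 0).2 hpi) S rfl
  rw [tendsto_zero_iff_norm_tendsto_zero, Metric.tendsto_nhds]
  intro ε hε
  filter_upwards [Metric.tendstoUniformlyOn_iff.1 hunif (ε / 2) (half_pos hε)] with i hi
  have hle : ‖Q i ∘L K‖ ≤ ε / 2 := by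
    refine ContinuousLinearMap.opNorm_le_of_unit_norm (half_pos hε).le fun v hv => ?_
    simpa using (hi (K v) (hKS ⟨v, by simpa using hv.le, rfl⟩)).le
  rw [dist_zero_right, norm_norm]
  linarith

end StrongConvergence

section SpectralProjection

variable {E : Type*} [NormedAddCommGroup E] [InnerProductSpace ℝ E]

/-- The orthogonal projection onto the span of the first `K` vectors of an orthonormal family. -/
noncomputable def spectralProj (e : ℕ → E) (K : ℕ) : E →L[ℝ] E :=
  ∑ j ∈ Finset.range K, tensor (e j) (e j)

lemma spectralProj_apply_self {e : ℕ → E} (he : Orthonormal ℝ e) (K j : ℕ) :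
    spectralProj e K (e j) = if j < K then e j else 0 := by
  simp only [spectralProj, sum_apply, tensor_apply, orthonormal_iff_ite.1 he, ite_smul, one_smul,
    zero_smul, Finset.sum_ite_eq', Finset.mem_range]

lemma norm_sum_smul_tensor_le {ι : Type*} {e : ι → E} (he : Orthonormal ℝ e) {s : Finset ι}
    {c : ι → ℝ} {M : ℝ} (hM : 0 ≤ M) (hc : ∀ j ∈ s, |c j| ≤ M) :
    ‖∑ j ∈ s, c j • tensor (e j) (e j)‖ ≤ M := by
  refine ContinuousLinearMap.opNorm_le_bound _ hM fun v => ?_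
  refine (sq_le_sq₀ (norm_nonneg _) (by positivity)).1 ?_
  have hnorm : ‖(∑ j ∈ s, c j • tensor (e j) (e j)) v‖ ^ 2 =
      ∑ j ∈ s, c j ^ 2 * ⟪e j, v⟫_ℝ ^ 2 := by
    simp only [sum_apply, smul_apply, tensor_apply, smul_smul]
    rw [← real_inner_self_eq_norm_sq, he.inner_sum]
    exact Finset.sum_congr rfl fun j _ => by rw [conj_trivial]; ring
  rw [hnorm, mul_pow]
  calc ∑ j ∈ s, c j ^ 2 * ⟪e j, v⟫_ℝ ^ 2 ≤ ∑ j ∈ s, M ^ 2 * ⟪e j, v⟫_ℝ ^ 2 := by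
        refine Finset.sum_le_sum fun j hj => ?_
        exact mul_le_mul_of_nonneg_right (sq_le_sq.2 ((hc j hj).trans (le_abs_self M)))
          (sq_nonneg _)
    _ = M ^ 2 * ∑ j ∈ s, ‖⟪e j, v⟫_ℝ‖ ^ 2 := by
        simp only [Finset.mul_sum, Real.norm_eq_abs, sq_abs]
    _ ≤ M ^ 2 * ‖v‖ ^ 2 := by gcongr; exact he.sum_inner_products_le v

lemma isStarProjection_spectralProj [CompleteSpace E] {e : ℕ → E} (he : Orthonormal ℝ e) (K : ℕ) :
    IsStarProjection (spectralProj e K) := by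
  induction K with
  | zero => simpa only [spectralProj, Finset.range_zero, Finset.sum_empty] using .zero _
  | succ K ih =>
    rw [spectralProj, Finset.sum_range_succ]
    refine ih.add (InnerProductSpace.isStarProjection_rankOne_self (he.norm_eq_one K)) ?_
    ext v
    change spectralProj e K (tensor (e K) (e K) v) = 0
    rw [tensor_apply, map_smul, spectralProj_apply_self he, if_neg (lt_irrefl K), smul_zero]

namespace SpectralDecomposition

variable {C : E →L[ℝ] E} {ev : ℕ → ℝ} {e : ℕ → E} {α : ℝ} {K : ℕ}

lemma apply_eigenvector (h : SpectralDecomposition C ev e) (j : ℕ) : C (e j) = ev j • e j := by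
  refine (h.hasSum (e j)).unique ?_
  have := hasSum_single (f := fun i => ev i • tensor (e i) (e i) (e j)) j fun i hi => by
    simp only [tensor_apply, h.orthonormal.2 hi, zero_smul, smul_zero]
  simpa only [tensor_apply, real_inner_self_eq_norm_sq, h.orthonormal.1 j, one_pow, one_smul]
    using this

lemma norm_one_sub_spectralProj_comp_le (h : SpectralDecomposition C ev e) (hα : 0 ≤ α)
    (hK : ∀ j, K ≤ j → ev j ≤ α) : ‖(1 - spectralProj e K) ∘L C‖ ≤ α := by
  refine ContinuousLinearMap.opNorm_le_bound _ hα fun v => ?_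
  let c : ℕ → ℝ := fun j => if j < K then 0 else ev j
  have hterm (j : ℕ) : (1 - spectralProj e K) (ev j • tensor (e j) (e j) v) =
      (c j • tensor (e j) (e j)) v := by
    rw [tensor_apply, map_smul, map_smul, sub_apply, spectralProj_apply_self h.orthonormal,
      smul_apply, tensor_apply]
    dsimp only [c]
    split_ifs <;> simp
  have hsum : HasSum (fun j => (c j • tensor (e j) (e j)) v)
      (((1 - spectralProj e K) ∘L C) v) := by
    simp only [← hterm]
    exact (h.hasSum v).mapL (1 - spectralProj e K)
  refine le_of_tendsto hsum.tendsto_sum_nat.norm (Eventually.of_forall fun N => ?_)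
  rw [← sum_apply]
  refine ContinuousLinearMap.le_of_opNorm_le _ (norm_sum_smul_tensor_le h.orthonormal hα ?_) v
  intro j _
  dsimp only [c]
  split_ifs with hj
  · rwa [abs_zero]
  · rw [abs_of_nonneg (h.nonneg j)]
    exact hK j (not_lt.1 hj)

lemma finite_setOf_lt [FiniteDimensional ℝ C.range] (h : SpectralDecomposition C ev e)
    (hα : 0 ≤ α) : {j | α < ev j}.Finite := by
  have hmem (j : {j | α < ev j}) : e j ∈ C.range := by
    refine ⟨(ev j)⁻¹ • e j, ?_⟩
    rw [ContinuousLinearMap.coe_coe, map_smul, h.apply_eigenvector,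
      inv_smul_smul₀ (hα.trans_lt j.2).ne']
  have hli : LinearIndependent ℝ fun j : {j | α < ev j} => (⟨e j, hmem j⟩ : C.range) :=
    LinearIndependent.of_comp C.range.subtype
      (h.orthonormal.linearIndependent.comp _ Subtype.val_injective)
  exact Set.finite_coe_iff.1 hli.finite

lemma lt_numRetained_iff [FiniteDimensional ℝ C.range] (h : SpectralDecomposition C ev e)
    (hα : 0 ≤ α) (j : ℕ) : j < numRetained ev α ↔ α < ev j := by
  have hlower : IsLowerSet {j | α < ev j} := fun i j hji hi => hi.trans_le (h.antitone hji)
  rcases hlower.eq_univ_or_Iio with huniv | ⟨k, hk⟩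
  · exact absurd (huniv ▸ h.finite_setOf_lt hα) Set.infinite_univ.not_finite
  · rw [numRetained, hk, Set.ncard_eq_toFinset_card', Set.toFinset_Iio, Nat.card_Iio]
    exact (Set.ext_iff.1 hk j).symm

lemma comp_regInverse (h : SpectralDecomposition C ev e) (hK : ∀ j < K, 0 < ev j) :
    C ∘L regInverse ev e K = spectralProj e K := by
  rw [regInverse, spectralProj, ContinuousLinearMap.comp_finsetSum]
  refine Finset.sum_congr rfl fun j hj => ContinuousLinearMap.ext fun v => ?_
  rw [ContinuousLinearMap.comp_apply, smul_apply, tensor_apply, smul_comm, map_smul, map_smul,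
    h.apply_eigenvector, inv_smul_smul₀ (hK j (Finset.mem_range.1 hj)).ne']

end SpectralDecomposition

section SpectralCutoff

variable [CompleteSpace E] {F : Type*} [NormedAddCommGroup F] [InnerProductSpace ℝ F]
  [CompleteSpace F]

lemma adjoint_regInverse (ev : ℕ → ℝ) (e : ℕ → E) (K : ℕ) :
    (regInverse ev e K).adjoint = regInverse ev e K := by
  simp only [regInverse, tensor, map_sum, map_smulₛₗ, InnerProductSpace.adjoint_rankOne,
    conj_trivial]

lemma norm_comp_regInverse_le {B : E →L[ℝ] F} {ev : ℕ → ℝ} {e : ℕ → E}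
    (h : SpectralDecomposition (B.adjoint ∘L B) ev e) {α : ℝ} (hα : 0 < α) {K : ℕ}
    (hK : ∀ j < K, α < ev j) : ‖B ∘L regInverse ev e K‖ ≤ √α⁻¹ := by
  set R := regInverse ev e K
  have hR : ‖R‖ ≤ α⁻¹ := norm_sum_smul_tensor_le h.orthonormal (inv_nonneg.2 hα.le) fun j hj => by
    rw [abs_of_nonneg (inv_nonneg.2 (h.nonneg j))]
    exact inv_anti₀ hα (hK j (Finset.mem_range.1 hj)).le
  have hP : ‖spectralProj e K‖ ≤ 1 := (isStarProjection_spectralProj h.orthonormal K).norm_le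
  have hsq : (B ∘L R).adjoint ∘L (B ∘L R) = R ∘L spectralProj e K := by
    rw [← h.comp_regInverse fun j hj => hα.trans (hK j hj), ContinuousLinearMap.adjoint_comp,
      adjoint_regInverse]
    rfl
  refine Real.le_sqrt_of_sq_le ?_
  calc ‖B ∘L R‖ ^ 2 = ‖R ∘L spectralProj e K‖ := by
        rw [← hsq, ContinuousLinearMap.norm_adjoint_comp_self, sq]
    _ ≤ ‖R‖ * ‖spectralProj e K‖ := ContinuousLinearMap.opNorm_comp_le _ _
    _ ≤ α⁻¹ * 1 := by gcongr
    _ = α⁻¹ := mul_one _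

lemma denseRange_of_isSelfAdjoint_of_injective {D : E →L[ℝ] E} (hD : IsSelfAdjoint D)
    (hinj : ∀ v, D v = 0 → v = 0) : DenseRange D := by
  have hker : D.ker = ⊥ := LinearMap.ker_eq_bot'.2 hinj
  have hclosure : D.range.topologicalClosure = ⊤ := by
    rw [← Submodule.orthogonal_orthogonal_eq_closure, ContinuousLinearMap.orthogonal_range,
      hD.adjoint_eq, hker, Submodule.bot_orthogonal_eq_top]
  exact Submodule.dense_iff_topologicalClosure_eq_top.2 hclosure

lemma tendsto_comp_isStarProjection {ι : Type*} {l : Filter ι} {A : E →L[ℝ] F}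
    (hA : IsCompactOperator A) {Q : ι → E →L[ℝ] E} (hQ : ∀ i, IsStarProjection (Q i))
    (hlim : ∀ v, Tendsto (fun i => Q i v) l (𝓝 0)) : Tendsto (fun i => A ∘L Q i) l (𝓝 0) := by
  have hQ1 (i : ι) : ‖Q i‖ ≤ 1 := (hQ i).norm_le
  have hgram : Tendsto (fun i => Q i ∘L (A.adjoint ∘L A)) l (𝓝 0) :=
    tendsto_comp_zero_of_isCompactOperator (hA.clm_comp A.adjoint) hQ1 hlim
  have hbound (i : ι) : ‖A ∘L Q i‖ ≤ √‖Q i ∘L (A.adjoint ∘L A)‖ := by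
    refine Real.le_sqrt_of_sq_le ?_
    have hsq : (A ∘L Q i).adjoint ∘L (A ∘L Q i) = (Q i ∘L (A.adjoint ∘L A)) ∘L Q i := by
      rw [ContinuousLinearMap.adjoint_comp, (hQ i).isSelfAdjoint.adjoint_eq]
      rfl
    calc ‖A ∘L Q i‖ ^ 2 = ‖(Q i ∘L (A.adjoint ∘L A)) ∘L Q i‖ := by
          rw [← hsq, ContinuousLinearMap.norm_adjoint_comp_self, sq]
      _ ≤ ‖Q i ∘L (A.adjoint ∘L A)‖ * ‖Q i‖ := ContinuousLinearMap.opNorm_comp_le _ _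
      _ ≤ ‖Q i ∘L (A.adjoint ∘L A)‖ := mul_le_of_le_one_right (norm_nonneg _) (hQ1 i)
  refine squeeze_zero_norm hbound ?_
  simpa only [norm_zero, Real.sqrt_zero] using hgram.norm.sqrt

lemma tendsto_comp_one_sub_spectralProj {A : E →L[ℝ] F} (hA : IsCompactOperator A)
    {D : E →L[ℝ] E} (hD : DenseRange D) {ι : Type*} {l : Filter ι} {Dn : ι → E →L[ℝ] E}
    (hlim : Tendsto Dn l (𝓝 D)) {ev : ι → ℕ → ℝ} {e : ι → ℕ → E}
    (hspec : ∀ n, SpectralDecomposition (Dn n) (ev n) (e n)) {α : ι → ℝ} (hα : ∀ n, 0 ≤ α n)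
    (hα0 : Tendsto α l (𝓝 0)) {K : ι → ℕ} (hK : ∀ n j, K n ≤ j → ev n j ≤ α n) :
    Tendsto (fun n => A ∘L (1 - spectralProj (e n) (K n))) l (𝓝 0) := by
  set Q : ι → E →L[ℝ] E := fun n => 1 - spectralProj (e n) (K n)
  have hQ (n : ι) : IsStarProjection (Q n) :=
    (isStarProjection_spectralProj (hspec n).orthonormal (K n)).one_sub
  have hQ1 (n : ι) : ‖Q n‖ ≤ 1 := (hQ n).norm_le
  have hQD (n : ι) : ‖Q n ∘L D‖ ≤ α n + ‖Dn n - D‖ := by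
    have hsplit : Q n ∘L D = Q n ∘L Dn n - Q n ∘L (Dn n - D) := by
      rw [ContinuousLinearMap.comp_sub, sub_sub_cancel]
    rw [hsplit]
    refine (norm_sub_le _ _).trans (add_le_add
      ((hspec n).norm_one_sub_spectralProj_comp_le (hα n) (hK n)) ?_)
    exact (ContinuousLinearMap.opNorm_comp_le _ _).trans
      (mul_le_of_le_one_left (norm_nonneg _) (hQ1 n))
  refine tendsto_comp_isStarProjection hA hQ (tendsto_apply_zero_of_denseRange hD hQ1 ?_)
  refine squeeze_zero_norm hQD ?_
  simpa only [add_zero] using hα0.add (tendsto_iff_norm_sub_tendsto_zero.1 hlim)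

end SpectralCutoff

end SpectralProjection

section EstimationError

variable {H : Type*} [NormedAddCommGroup H] [InnerProductSpace ℝ H]
  {Ω : Type*} {x y z u : ℕ → Ω → H}

lemma sampleMoment_apply (T : ℕ) (ω : Ω) (v : H) :
    sampleMoment x z T ω v = (T : ℝ)⁻¹ • ∑ t ∈ Finset.range T, ⟪x t ω, v⟫_ℝ • z t ω := by
  simp only [sampleMoment, smul_apply, sum_apply, tensor_apply]

instance finiteDimensional_range_sampleMoment (T : ℕ) (ω : Ω) :
    FiniteDimensional ℝ (sampleMoment x z T ω).range := by
  have hle : (sampleMoment x z T ω).range ≤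
      Submodule.span ℝ ((fun t => z t ω) '' (Finset.range T : Set ℕ)) := by
    rintro _ ⟨v, rfl⟩
    rw [ContinuousLinearMap.coe_coe, sampleMoment_apply]
    exact Submodule.smul_mem _ _ (Submodule.sum_mem _ fun t ht =>
      Submodule.smul_mem _ _ (Submodule.subset_span ⟨t, ht, rfl⟩))
  have := FiniteDimensional.span_of_finite ℝ
    ((Finset.range T).finite_toSet.image fun t => z t ω)
  exact Submodule.finiteDimensional_of_le hle

instance finiteDimensional_range_comp {E F G : Type*} [NormedAddCommGroup E] [NormedSpace ℝ E]
    [NormedAddCommGroup F] [NormedSpace ℝ F] [NormedAddCommGroup G] [NormedSpace ℝ G]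
    (R : F →L[ℝ] G) (S : E →L[ℝ] F) [FiniteDimensional ℝ S.range] :
    FiniteDimensional ℝ (R ∘L S).range := by
  have hmap : (R ∘L S).range = S.range.map R.toLinearMap := LinearMap.range_comp _ _
  rw [hmap]
  infer_instance

variable [CompleteSpace H]

lemma sampleMoment_eq_comp_adjoint_add {A : H →L[ℝ] H} {ω : Ω}
    (hy : ∀ t, y t ω = A (x t ω) + u t ω) (T : ℕ) :
    sampleMoment y z T ω = sampleMoment x z T ω ∘L A.adjoint + sampleMoment u z T ω := by
  ext v
  simp only [add_apply, ContinuousLinearMap.comp_apply, sampleMoment_apply, hy, inner_add_left,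
    add_smul, ContinuousLinearMap.adjoint_inner_right, Finset.sum_add_distrib, smul_add]

lemma estimator_sub_eq {A : H →L[ℝ] H} {ω : Ω} (hy : ∀ t, y t ω = A (x t ω) + u t ω) (T : ℕ)
    {ev : ℕ → ℝ} {e : ℕ → H} (h : SpectralDecomposition
      ((sampleMoment x z T ω).adjoint ∘L sampleMoment x z T ω) ev e) {α : ℝ} (hα : 0 ≤ α) :
    estimator x y z T ω ev e α - A =
      (sampleMoment u z T ω).adjoint ∘L
          (sampleMoment x z T ω ∘L regInverse ev e (numRetained ev α)) -
        A ∘L (1 - spectralProj e (numRetained ev α)) := by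
  have hproj := h.comp_regInverse (K := numRetained ev α) fun j hj =>
    hα.trans_lt ((h.lt_numRetained_iff hα j).1 hj)
  rw [estimator, sampleMoment_eq_comp_adjoint_add hy, map_add, ContinuousLinearMap.adjoint_comp,
    ContinuousLinearMap.adjoint_adjoint, ← hproj]
  ext v
  simp only [add_apply, sub_apply, ContinuousLinearMap.comp_apply, map_sub, one_apply_eq_self]
  abel

lemma tendsto_adjoint_comp_self {F ι : Type*} [NormedAddCommGroup F] [InnerProductSpace ℝ F]
    [CompleteSpace F] {l : Filter ι} {B : ι → H →L[ℝ] F} {C : H →L[ℝ] F}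
    (h : Tendsto B l (𝓝 C)) :
    Tendsto (fun i => (B i).adjoint ∘L B i) l (𝓝 (C.adjoint ∘L C)) :=
  ((ContinuousLinearMap.compL ℝ H F H).continuous₂.tendsto _).comp
    (((ContinuousLinearMap.adjoint.continuous.tendsto _).comp h).prodMk_nhds h)

lemma tendsto_adjoint_comp_regInverse {F G ι : Type*} [NormedAddCommGroup F]
    [InnerProductSpace ℝ F] [CompleteSpace F] [NormedAddCommGroup G] [InnerProductSpace ℝ G]
    [CompleteSpace G] {l : Filter ι} {N : ι → G →L[ℝ] F} {B : ι → H →L[ℝ] F} {r α : ι → ℝ}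
    {ev : ι → ℕ → ℝ} {e : ι → ℕ → H} {K : ι → ℕ} (hN : N =O[l] fun i => √(r i))
    (hspec : ∀ i, SpectralDecomposition ((B i).adjoint ∘L B i) (ev i) (e i)) (hα : ∀ i, 0 < α i)
    (hK : ∀ i, ∀ j < K i, α i < ev i j) (hr : Tendsto (fun i => (α i)⁻¹ * r i) l (𝓝 0)) :
    Tendsto (fun i => (N i).adjoint ∘L (B i ∘L regInverse (ev i) (e i) (K i))) l (𝓝 0) := by
  have hR : (fun i => B i ∘L regInverse (ev i) (e i) (K i)) =O[l] fun i => √(α i)⁻¹ :=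
    IsBigO.of_bound' (Eventually.of_forall fun i => by
      rw [Real.norm_of_nonneg (Real.sqrt_nonneg _)]
      exact norm_comp_regInverse_le (hspec i) (hα i) (hK i))
  have hprod : (fun i => (N i).adjoint ∘L (B i ∘L regInverse (ev i) (e i) (K i)))
      =O[l] fun i => √((α i)⁻¹ * r i) := by
    refine (IsBigO.of_bound' (Eventually.of_forall fun i => ?_)).trans
      ((hR.norm_left.mul hN.norm_left).congr_right fun i =>
        (Real.sqrt_mul (inv_nonneg.2 (hα i).le) (r i)).symm)
    rw [norm_mul, norm_norm, norm_norm, mul_comm, ← LinearIsometryEquiv.norm_map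
      ContinuousLinearMap.adjoint (N i)]
    exact ContinuousLinearMap.opNorm_comp_le _ _
  exact hprod.trans_tendsto (by simpa only [Real.sqrt_zero] using hr.sqrt)

end EstimationError

section Martingale

variable {E F G Ω : Type*} [NormedAddCommGroup E] [NormedSpace ℝ E] [CompleteSpace E]
  [NormedAddCommGroup F] [NormedSpace ℝ F] [NormedAddCommGroup G] [NormedSpace ℝ G]
  [CompleteSpace G] {mΩ : MeasurableSpace Ω} {μ : Measure Ω} [IsFiniteMeasure μ]

lemma martingale_sum_of_condExp_eq_zero {𝒢 : Filtration ℕ mΩ} (B : E →L[ℝ] F →L[ℝ] G)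
    {u : ℕ → Ω → E} {z : ℕ → Ω → F} (hu : ∀ t, StronglyMeasurable[𝒢 (t + 1)] (u t))
    (hz : ∀ t, StronglyMeasurable[𝒢 t] (z t)) (hui : ∀ t, Integrable (u t) μ)
    (huz : ∀ t, Integrable (fun ω => B (u t ω) (z t ω)) μ) (hdiff : ∀ t, μ[u t | 𝒢 t] =ᵐ[μ] 0) :
    Martingale (fun n ω => ∑ t ∈ Finset.range n, B (u t ω) (z t ω)) 𝒢 μ := by
  refine martingale_of_condExp_sub_eq_zero_nat (fun n => ?_) (fun n => ?_) fun n => ?_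
  · refine Finset.stronglyMeasurable_fun_sum _ fun t ht => ?_
    have htn : t + 1 ≤ n := Finset.mem_range.1 ht
    exact B.continuous₂.comp_stronglyMeasurable (((hu t).mono (𝒢.mono htn)).prodMk
      ((hz t).mono (𝒢.mono (t.le_succ.trans htn))))
  · exact integrable_finsetSum _ fun t _ => huz t
  · have hincr : ((fun ω => ∑ t ∈ Finset.range (n + 1), B (u t ω) (z t ω)) -
        fun ω => ∑ t ∈ Finset.range n, B (u t ω) (z t ω)) = fun ω => B (u n ω) (z n ω) :=
      funext fun ω => by rw [Pi.sub_apply, Finset.sum_range_succ, add_sub_cancel_left]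
    rw [hincr]
    filter_upwards [condExp_bilin_of_stronglyMeasurable_right B (hz n) (huz n) (hui n), hdiff n]
      with ω hpull hzero
    rw [hpull, hzero, Pi.zero_apply, map_zero, zero_apply, Pi.zero_apply]

end Martingale

section PastFiltration

variable {Ω S : Type*} {mΩ : MeasurableSpace Ω} [MeasurableSpace S] {z u : ℕ → Ω → S}

/-- The filtration `t ↦ pastSigma z u t` of a regression in which the instrument `z t` is known
just before the error `u t`. -/
def pastFiltration (hz : ∀ t, Measurable (z t)) (hu : ∀ t, Measurable (u t)) :
    Filtration ℕ mΩ where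
  seq := pastSigma z u
  mono' _ _ hst := sup_le_sup (biSup_mono fun _ h => h.trans hst)
    (biSup_mono fun _ h => h.trans_le hst)
  le' _ := sup_le (iSup₂_le fun s _ => (hz s).comap_le) (iSup₂_le fun s _ => (hu s).comap_le)

lemma measurable_pastSigma_left {s t : ℕ} (hst : s ≤ t) : Measurable[pastSigma z u t] (z s) :=
  Measurable.of_comap_le (le_sup_of_le_left
    (le_iSup₂ (f := fun s (_ : s ≤ t) => MeasurableSpace.comap (z s) inferInstance) s hst))

lemma measurable_pastSigma_right {s t : ℕ} (hst : s < t) : Measurable[pastSigma z u t] (u s) :=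
  Measurable.of_comap_le (le_sup_of_le_right
    (le_iSup₂ (f := fun s (_ : s < t) => MeasurableSpace.comap (u s) inferInstance) s hst))

end PastFiltration

section SampleMoments

variable {H : Type*} [NormedAddCommGroup H] [InnerProductSpace ℝ H] [CompleteSpace H]
  [TopologicalSpace.SeparableSpace H] [MeasurableSpace H] [BorelSpace H]
  {Ω : Type*} {mΩ : MeasurableSpace Ω} {μ : Measure Ω} [IsProbabilityMeasure μ]
  {x z u : ℕ → Ω → H} {a b : ℝ}

lemma ae_tendsto_sampleMoment (hx : ∀ t, Measurable (x t)) (hz : ∀ t, Measurable (z t))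
    (hst : StrictlyStationary μ fun t ω => (x t ω, z t ω))
    (hmix : GeometricallyStronglyMixing μ fun t ω => (x t ω, z t ω))
    (ha : ∀ᵐ ω ∂μ, ‖x 0 ω‖ ≤ a) (hb : ∀ᵐ ω ∂μ, ‖z 0 ω‖ ≤ b) :
    ∀ᵐ ω ∂μ, Tendsto (fun T => sampleMoment x z T ω) atTop (𝓝 (crossMoment μ (x 0) (z 0))) := by
  have : SecondCountableTopology H := UniformSpace.secondCountable_of_separable H
  have hw (t : ℕ) : Measurable fun ω => (x t ω, z t ω) := (hx t).prodMk (hz t)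
  have hg : StronglyMeasurable fun p : H × H => tensor p.1 p.2 :=
    continuous_tensor.stronglyMeasurable
  have hbound : ∀ᵐ p ∂μ.map fun ω => (x 0 ω, z 0 ω), ‖tensor p.1 p.2‖ ≤ a * b := by
    rw [ae_map_iff (hw 0).aemeasurable (measurableSet_le hg.measurable.norm measurable_const)]
    filter_upwards [ha, hb] with ω hxω hzω
    rw [norm_tensor]
    exact mul_le_mul hxω hzω (norm_nonneg _) ((norm_nonneg _).trans hxω)
  have hmean : ∫ p, tensor p.1 p.2 ∂μ.map (fun ω => (x 0 ω, z 0 ω)) =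
      crossMoment μ (x 0) (z 0) :=
    integral_map (hw 0).aemeasurable hg.aestronglyMeasurable
  rw [← hmean]
  exact ae_tendsto_average hw hst hmix hg hbound

lemma martingale_sum_tensorHS (hz : ∀ t, Measurable (z t)) (hu : ∀ t, Measurable (u t))
    (hmds : ∀ t, μ[u t | pastSigma z u t] =ᵐ[μ] 0)
    (ha : ∀ᵐ ω ∂μ, ∀ t, ‖u t ω‖ ≤ a) (hb : ∀ᵐ ω ∂μ, ∀ t, ‖z t ω‖ ≤ b) :
    Martingale (fun n ω => ∑ t ∈ Finset.range n, tensorHS (u t ω) (z t ω))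
      (pastFiltration hz hu) μ := by
  have : SecondCountableTopology H := UniformSpace.secondCountable_of_separable H
  refine martingale_sum_of_condExp_eq_zero tensorHSL
    (fun t => (measurable_pastSigma_right t.lt_succ_self).stronglyMeasurable)
    (fun t => (measurable_pastSigma_left le_rfl).stronglyMeasurable) (fun t => ?_) (fun t => ?_)
    hmds
  · exact .of_bound (hu t).aestronglyMeasurable a (ha.mono fun ω hω => hω t)
  · refine .of_bound (C := a * b) (tensorHSL.continuous₂.comp_stronglyMeasurable
      ((hu t).stronglyMeasurable.prodMk (hz t).stronglyMeasurable)).aestronglyMeasurable ?_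
    filter_upwards [ha, hb] with ω huω hzω
    rw [tensorHSL_apply, HilbertSchmidt.norm_tensorHS]
    exact mul_le_mul (huω t) (hzω t) (norm_nonneg _) ((norm_nonneg _).trans (huω t))

lemma ae_isBigO_sampleMoment (hz : ∀ t, Measurable (z t)) (hu : ∀ t, Measurable (u t))
    (hmds : ∀ t, μ[u t | pastSigma z u t] =ᵐ[μ] 0)
    (ha : ∀ᵐ ω ∂μ, ∀ t, ‖u t ω‖ ≤ a) (hb : ∀ᵐ ω ∂μ, ∀ t, ‖z t ω‖ ≤ b) :
    ∀ᵐ ω ∂μ, (fun T => sampleMoment u z T ω) =O[atTop]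
      fun T : ℕ => √((T : ℝ)⁻¹ * Real.log T) := by
  have hincr (n : ℕ) : ∀ᵐ ω ∂μ, ‖∑ t ∈ Finset.range (n + 1), tensorHS (u t ω) (z t ω) -
      ∑ t ∈ Finset.range n, tensorHS (u t ω) (z t ω)‖ ≤ a * b := by
    filter_upwards [ha, hb] with ω huω hzω
    rw [Finset.sum_range_succ, add_sub_cancel_left, HilbertSchmidt.norm_tensorHS]
    exact mul_le_mul (huω n) (hzω n) (norm_nonneg _) ((norm_nonneg _).trans (huω n))
  have hscale (T : ℕ) : (T : ℝ)⁻¹ * √(T * Real.log T) = √((T : ℝ)⁻¹ * Real.log T) := by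
    rw [← Real.sqrt_sq (by positivity : 0 ≤ (T : ℝ)⁻¹), ← Real.sqrt_mul (by positivity),
      Real.sqrt_sq (by positivity)]
    congr 1
    rcases T.eq_zero_or_pos with rfl | hT
    · simp
    · field_simp
  filter_upwards [ae_isBigO_sqrt_mul_log_of_martingale (martingale_sum_tensorHS hz hu hmds ha hb)
    (funext fun _ => Finset.sum_range_zero _) hincr] with ω hω
  have hHS : (fun T => sampleMomentHS u z T ω) =O[atTop]
      fun T : ℕ => √((T : ℝ)⁻¹ * Real.log T) :=
    ((isBigO_refl (fun T : ℕ => (T : ℝ)⁻¹) atTop).smul hω).congr_right hscale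
  exact (IsBigO.of_norm_le fun T => norm_sampleMoment_le u z T ω).trans hHS.norm_left

end SampleMoments

end FIVE

theorem theorem1_general {H : Type*} [NormedAddCommGroup H] [InnerProductSpace ℝ H]
    [CompleteSpace H] [TopologicalSpace.SeparableSpace H] [MeasurableSpace H] [BorelSpace H]
    {Ω : Type*} [MeasurableSpace Ω] {μ : Measure Ω} [IsProbabilityMeasure μ]
    {A : H →L[ℝ] H} (hA : IsCompactOperator A) {x y z u : ℕ → Ω → H}
    (hx : ∀ t, Measurable (x t)) (hz : ∀ t, Measurable (z t)) (hu : ∀ t, Measurable (u t))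
    (hy : ∀ t, ∀ᵐ ω ∂μ, y t ω = A (x t ω) + u t ω)
    (hst : FIVE.StrictlyStationary μ fun t ω => (x t ω, z t ω))
    (hmix : FIVE.GeometricallyStronglyMixing μ fun t ω => (x t ω, z t ω))
    (hmds : ∀ t, μ[u t | FIVE.pastSigma z u t] =ᵐ[μ] 0)
    (hker : ∀ v, (FIVE.crossMoment μ (x 0) (z 0)).adjoint
      (FIVE.crossMoment μ (x 0) (z 0) v) = 0 → v = 0)
    {a b c : ℝ} (ha : ∀ᵐ ω ∂μ, ‖x 0 ω‖ ≤ a) (hb : ∀ᵐ ω ∂μ, ∀ t, ‖z t ω‖ ≤ b)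
    (hc : ∀ᵐ ω ∂μ, ∀ t, ‖u t ω‖ ≤ c) {ev : ℕ → Ω → ℕ → ℝ} {e : ℕ → Ω → ℕ → H}
    (hspec : ∀ T ω, FIVE.SpectralDecomposition
      ((FIVE.sampleMoment x z T ω).adjoint ∘L FIVE.sampleMoment x z T ω) (ev T ω) (e T ω))
    {α : ℕ → ℝ} (hα : ∀ T, 0 < α T) (hα0 : Tendsto α atTop (𝓝 0))
    (hαT : Tendsto (fun T : ℕ => (α T)⁻¹ * (T : ℝ)⁻¹ * Real.log T) atTop (𝓝 0)) :
    ∀ᵐ ω ∂μ, Tendsto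
      (fun T : ℕ => ‖FIVE.estimator x y z T ω (ev T ω) (e T ω) (α T) - A‖) atTop (𝓝 0) := by
  have hdense := FIVE.denseRange_of_isSelfAdjoint_of_injective
    (ContinuousLinearMap.isPositive_adjoint_comp_self
      (FIVE.crossMoment μ (x 0) (z 0))).isSelfAdjoint hker
  filter_upwards [ae_all_iff.2 hy, FIVE.ae_isBigO_sampleMoment hz hu hmds hc hb,
    FIVE.ae_tendsto_sampleMoment hx hz hst hmix ha (hb.mono fun ω hω => hω 0)]
    with ω hyω hnoise hmoment
  have hK (T j : ℕ) := (hspec T ω).lt_numRetained_iff (hα T).le j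
  have hbias := FIVE.tendsto_comp_one_sub_spectralProj hA hdense
    (FIVE.tendsto_adjoint_comp_self hmoment) (fun T => hspec T ω) (fun T => (hα T).le) hα0
    fun T j hj => not_lt.1 fun h => hj.not_gt ((hK T j).2 h)
  have hvariance := FIVE.tendsto_adjoint_comp_regInverse hnoise (fun T => hspec T ω) hα
    (fun T j hj => (hK T j).1 hj) (by simpa only [mul_assoc] using hαT)
  simp only [FIVE.estimator_sub_eq hyω _ (hspec _ ω) (hα _).le]
  simpa only [sub_zero, norm_zero] using (hvariance.sub hbias).norm

theorem theorem1 {H : Type*} [NormedAddCommGroup H] [InnerProductSpace ℝ H] [CompleteSpace H]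
    [TopologicalSpace.SeparableSpace H] [MeasurableSpace H] [BorelSpace H]
    {Ω : Type*} [MeasurableSpace Ω] (μ : Measure Ω) [IsProbabilityMeasure μ]
    (A : H →L[ℝ] H) (x y z u : ℕ → Ω → H) (lam : ℕ → ℝ) (f : ℕ → H)
    (hmodel : FIVE.ModelAssumption μ A x y z u lam f)
    (hstrong : FIVE.StrongAssumption μ x z u)
    -- any eigenvalues and eigenfunctions of the sample operator `Ĉ_xz* Ĉ_xz`
    (ev : ℕ → Ω → ℕ → ℝ) (e : ℕ → Ω → ℕ → H)
    (hspec : ∀ T ω, FIVE.SpectralDecomposition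
      ((FIVE.sampleMoment x z T ω).adjoint ∘L FIVE.sampleMoment x z T ω) (ev T ω) (e T ω))
    -- the regularization parameter
    (α : ℕ → ℝ) (hα : ∀ T, 0 < α T) (hα0 : Tendsto α atTop (𝓝 0))
    (hτ : ∀ᵐ ω ∂μ,
      (fun T : ℕ => ∑ j ∈ Finset.range (FIVE.numRetained (ev T ω) (α T)), FIVE.gapWeight lam j)
        =o[atTop] fun T : ℕ => (T : ℝ) ^ (1 / 2 : ℝ) * Real.log T ^ (-(3 / 2) : ℝ))
    (hαT : Tendsto (fun T : ℕ => (α T)⁻¹ * (T : ℝ)⁻¹ * Real.log T) atTop (𝓝 0)) :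
    ∀ᵐ ω ∂μ, Tendsto
      (fun T : ℕ => ‖FIVE.estimator x y z T ω (ev T ω) (e T ω) (α T) - A‖) atTop (𝓝 0) := by
  obtain ⟨⟨a, ha⟩, ⟨b, hb⟩, ⟨c, hc⟩, -⟩ := hstrong
  exact theorem1_general hmodel.hilbertSchmidt.isCompactOperator hmodel.measurable_x
    hmodel.measurable_z hmodel.measurable_u hmodel.model hmodel.stationary hmodel.mixing
    hmodel.martingale_diff hmodel.identified (ha.mono fun ω hω => hω 0) hb hc hspec hα hα0 hαT
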